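/- **Definitions.** All Banach spaces are real. The modulus of smoothness of a Banach space $X$ is $\rho(u)=\sup_{\|x\|=\|y\|=1}\frac{\|x+uy\|+\|x-uy\|}{2}-1$, and $X$ is uniformly smooth if $\rho(u)=o(u)$ as $u\to0$. For $1<q\le 2$, $\mathcal P_q$ is the class of all uniformly smooth Banach spaces such that, for some $\gamma>0$, $\rho(u)\le\gamma u^q$ for all $u>0$. A dictionary is a set $\mathcal D\subset X$ with $\overline{\mathrm{span}}\,\mathcal D=X$, $\|g\|=1$ for all $g\in\mathcal D$, and $-g\in\mathcal D$ whenever $g\in\mathcal D$. Let $\{(t_n,t'_n)\}_{n\ge1}$, $\{(\delta_n,\delta'_n)\}_{n\ge0}$, $\{(\eta_n,\eta'_n)\}_{n\ge1}$ be sequences of non-negative numbers with $t_n\le 1$. A realization of the generalized Approximate Weak Chebyshev Greedy Algorithm (gAWCGA) of $f\in X$ with these parameters consists of sequences obtained as follows: put $f_0=f$ and, for every $n\ge1$, 1. take a bounded linear functional $F_{n-1}$ with $\|F_{n-1}\|\le1$ and $F_{n-1}(f_{n-1})\ge(1-\delta_{n-1})\|f_{n-1}\|-\delta'_{n-1}$;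 2. take $\phi_n\in\mathcal D$ with $F_{n-1}(\phi_n)\ge t_n\sup_{g\in\mathcal D}F_{n-1}(g)-t'_n$; 3. with $\Phi_n=\mathrm{span}\{\phi_1,\dots,\phi_n\}$ and $E_n=\inf_{G\in\Phi_n}\|f-G\|$, take $G_n\in\Phi_n$ with $\|f-G_n\|\le(1+\eta_n)E_n+\eta'_n$, and put $f_n=f-G_n$. The gAWCGA of $f$ converges if $G_n\to f$ for every realization, and diverges if $G_n\not\to f$ for some realization. **Theorem 2.** Let $1<q\le2$, $p=q/(q-1)$, and let the parameter sequences be given. The gAWCGA with these parameters converges for every Banach space $X\in\mathcal P_q$, every dictionary $\mathcal D\subset X$ and every $f\in X$ if and only if both of the following hold: (a) $\sup_{n\ge1}\eta_n<\infty$ and $\lim_{n\to\infty}\eta'_n=0$; (b) there is a strictly increasing sequence $\{n_k\}_{k\ge1}$ of positive integers such that, as $k\to\infty$, $\sum_{k=1}^\infty t_{n_k+1}^p=\infty$, $t'_{n_k+1}=o(t_{n_k+1})$, $\delta_{n_k}=o(t_{n_k+1}^p)$, $\delta'_{n_k}=o(t_{n_k+1}^p)$, $\eta_{n_k}=o(t_{n_k+1}^p)$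 and $\eta'_{n_k}=o(t_{n_k+1}^p)$. (Here $a_k=o(b_k)$ means that for every $c>0$ one has $|a_k|\le c|b_k|$ for all large $k$.) Moreover, $\ell_q\in\mathcal P_q$, the set $\mathcal D=\{\pm e_i\}_{i\ge0}$, where $\{e_i\}_{i\ge0}$ is the canonical basis of $\ell_q$, is a dictionary in $\ell_q$, and if (a) or (b) fails then there is an $f\in\ell_q$ whose gAWCGA with respect to $\mathcal D$ diverges. -/

import Mathlib

open Filter Topology Asymptotics

universe u

namespace GAWCGA

/-- The modulus of smoothness of a real normed space,
`ρ(u) = sup_{‖x‖ = ‖y‖ = 1} (‖x + u y‖ + ‖x - u y‖) / 2 - 1`. The set is bounded above by `|u|`. -/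
noncomputable def modulusOfSmoothness (X : Type u) [NormedAddCommGroup X] [NormedSpace ℝ X]
    (u : ℝ) : ℝ :=
  sSup {r : ℝ | ∃ x y : X, ‖x‖ = 1 ∧ ‖y‖ = 1 ∧ r = (‖x + u • y‖ + ‖x - u • y‖) / 2 - 1}

/-- `ρ(u) = o(u)` as `u → 0`. -/
def IsUniformlySmooth (X : Type u) [NormedAddCommGroup X] [NormedSpace ℝ X] : Prop :=
  (fun u : ℝ => modulusOfSmoothness X u) =o[𝓝[≠] 0] (fun u : ℝ => u)

/-- Membership in the class `P_q` (used for `1 < q ≤ 2` and complete `X`): the space is uniformly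
smooth and its modulus of smoothness is of power type `q`. Since `ρ` is even and `ρ(0) = 0`, it is
enough to speak of `u > 0`. -/
def InClassP (q : ℝ) (X : Type u) [NormedAddCommGroup X] [NormedSpace ℝ X] : Prop :=
  IsUniformlySmooth X ∧ ∃ γ : ℝ, 0 < γ ∧ ∀ u : ℝ, 0 < u → modulusOfSmoothness X u ≤ γ * u ^ q

/-- A (symmetric) dictionary: normalized elements whose closed linear span is the whole space. -/
structure IsDictionary {X : Type u} [NormedAddCommGroup X] [NormedSpace ℝ X] (D : Set X) :
    Prop where
  norm_eq_one : ∀ g ∈ D, ‖g‖ = 1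
  neg_mem : ∀ g ∈ D, -g ∈ D
  dense_span : (Submodule.span ℝ D).topologicalClosure = ⊤

/-- A weakness sequence `(t_n, t'_n)_{n ≥ 1}`, a perturbation sequence `(δ_n, δ'_n)_{n ≥ 0}` and
an error sequence `(η_n, η'_n)_{n ≥ 1}`. The values of `t, t', η, η'` at `0` carry no meaning. -/
structure Parameters where
  t : ℕ → ℝ
  t' : ℕ → ℝ
  δ : ℕ → ℝ
  δ' : ℕ → ℝ
  η : ℕ → ℝ
  η' : ℕ → ℝ
  t_nonneg : ∀ n, 1 ≤ n → 0 ≤ t n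
  t_le_one : ∀ n, 1 ≤ n → t n ≤ 1
  t'_nonneg : ∀ n, 1 ≤ n → 0 ≤ t' n
  δ_nonneg : ∀ n, 0 ≤ δ n
  δ'_nonneg : ∀ n, 0 ≤ δ' n
  η_nonneg : ∀ n, 1 ≤ n → 0 ≤ η n
  η'_nonneg : ∀ n, 1 ≤ n → 0 ≤ η' n

section Algorithm

variable {X : Type u} [NormedAddCommGroup X] [NormedSpace ℝ X]

/-- `Φ_n = span {φ_1, …, φ_n}`. -/
def approxSpace (φ : ℕ → X) (n : ℕ) : Submodule ℝ X :=
  Submodule.span ℝ (φ '' Set.Icc 1 n)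

/-- `E_n = inf_{G ∈ Φ_n} ‖f - G‖`. -/
noncomputable def bestError (f : X) (φ : ℕ → X) (n : ℕ) : ℝ :=
  ⨅ G : approxSpace φ n, ‖f - (G : X)‖

/-- `(F_n)_{n ≥ 0}`, `(φ_n)_{n ≥ 1}`, `(G_n)_{n ≥ 0}` (with `G_0 = 0`) form a realization of the
generalized Approximate Weak Chebyshev Greedy Algorithm of `f` with respect to `D`. The `n`-th
remainder is `f_n = f - G_n`; the value `φ 0` plays no role. -/
structure IsRealization (P : Parameters) (D : Set X) (f : X)
    (F : ℕ → (X →L[ℝ] ℝ)) (φ : ℕ → X) (G : ℕ → X) : Prop where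
  init : G 0 = 0
  functional_norm : ∀ n, ‖F n‖ ≤ 1
  functional_apply : ∀ n, F n (f - G n) ≥ (1 - P.δ n) * ‖f - G n‖ - P.δ' n
  mem_dictionary : ∀ n, 1 ≤ n → φ n ∈ D
  greedy : ∀ n, 1 ≤ n → F (n - 1) (φ n) ≥ P.t n * (⨆ g : D, F (n - 1) (g : X)) - P.t' n
  mem_approxSpace : ∀ n, 1 ≤ n → G n ∈ approxSpace φ n
  approx : ∀ n, 1 ≤ n → ‖f - G n‖ ≤ (1 + P.η n) * bestError f φ n + P.η' n

/-- The algorithm of `f` converges: every realization has `G_n → f`. -/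
def Converges (P : Parameters) (D : Set X) (f : X) : Prop :=
  ∀ (F : ℕ → (X →L[ℝ] ℝ)) (φ G : ℕ → X), IsRealization P D f F φ G → Tendsto G atTop (𝓝 f)

/-- The algorithm of `f` diverges: some realization has `G_n ↛ f`. -/
def Diverges (P : Parameters) (D : Set X) (f : X) : Prop :=
  ∃ (F : ℕ → (X →L[ℝ] ℝ)) (φ G : ℕ → X), IsRealization P D f F φ G ∧ ¬ Tendsto G atTop (𝓝 f)

end Algorithm

/-- The algorithm converges for every Banach space in `P_q`, every dictionary and every element. -/
def ConvergesOnClassP (q : ℝ) (P : Parameters) : Prop :=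
  ∀ (X : Type u) [NormedAddCommGroup X] [NormedSpace ℝ X] [CompleteSpace X],
    InClassP q X → ∀ D : Set X, IsDictionary D → ∀ f : X, Converges P D f

/-- `sup_{n ≥ 1} η_n < ∞` and `η'_n → 0`. -/
def ErrorCondition (P : Parameters) : Prop :=
  BddAbove (P.η '' Set.Ici 1) ∧ Tendsto P.η' atTop (𝓝 0)

/-- There is an increasing sequence `n_k` of positive integers along which `∑ t_{n_k+1}^p = ∞`,
`t'_{n_k+1} = o(t_{n_k+1})`, and `δ_{n_k}, δ'_{n_k}, η_{n_k}, η'_{n_k}` are `o(t_{n_k+1}^p)`. -/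
def SubsequenceCondition (p : ℝ) (P : Parameters) : Prop :=
  ∃ n : ℕ → ℕ, StrictMono n ∧ (∀ k, 1 ≤ n k) ∧
    Tendsto (fun N : ℕ => ∑ k ∈ Finset.range N, P.t (n k + 1) ^ p) atTop atTop ∧
    (fun k => P.t' (n k + 1)) =o[atTop] (fun k => P.t (n k + 1)) ∧
    (fun k => P.δ (n k)) =o[atTop] (fun k => P.t (n k + 1) ^ p) ∧
    (fun k => P.δ' (n k)) =o[atTop] (fun k => P.t (n k + 1) ^ p) ∧
    (fun k => P.η (n k)) =o[atTop] (fun k => P.t (n k + 1) ^ p) ∧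
    (fun k => P.η' (n k)) =o[atTop] (fun k => P.t (n k + 1) ^ p)

/-- The real sequence space `ℓ_q`. -/
abbrev ellq (q : ℝ) : Type := lp (fun _ : ℕ => ℝ) (ENNReal.ofReal q)

/-- The canonical dictionary `{± e_i}` of `ℓ_q`. -/
noncomputable def canonicalDictionary (q : ℝ) : Set (ellq q) :=
  {g | ∃ i : ℕ, g = lp.single (ENNReal.ofReal q) i (1 : ℝ) ∨
    g = -lp.single (ENNReal.ofReal q) i (1 : ℝ)}

/-- For `q > 1` the exponent is at least `1`, so that `ℓ_q` carries its norm. -/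
theorem fact_one_le {q : ℝ} (hq : 1 < q) : Fact (1 ≤ ENNReal.ofReal q) :=
  ⟨by simpa using ENNReal.ofReal_le_ofReal hq.le⟩

end GAWCGA

namespace GAWCGA

/-! ### The space `ℓ_q` and its canonical dictionary -/

/-! Sufficiency. The best errors `E_n` decrease; if they do not tend to zero, they stay above some
`α > 0`. Power-type smoothness gives `‖x + y‖ + ‖x - y‖ ≤ 2‖x‖ + K‖y‖^q` for `‖x‖ ≥ α`, and since
`F_n` nearly norms `f_n`, this yields `‖f_n - y‖ + F_n y ≤ ‖f_n‖ + error + K‖y‖^q`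
(`norm_sub_add_apply_le`). This bound is used twice. Taking for `y` a small negative multiple of
`G_n`, near-optimality of `G_n` keeps `F_n(G_n)` from being very negative; hence `F_n` is bounded
below at an element of the span of the dictionary close to `f` (`le_apply_of_small_errors`), and so
is its supremum over the dictionary. Taking for `y` a multiple of `φ_{n+1}` of order `t^{1/(q-1)}`,
the gain `F_n y` and the cost `K‖y‖^q` are both of order `t^p`, and a small factor makes the gain
win: `E_n` drops by a constant times `t^p` (`bestError_succ_le`). Divergence of `∑ t^p` along the
subsequence contradicts `E_n ≥ 0`. Condition (a) carries convergence from `E_n` to `f_n`.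

Necessity. In `ℓ_q` everything is explicit: the best approximation deletes the chosen coordinates,
and the norming functional of a non-negative `z` takes the value `z_i^{q-1} / ‖z‖^{q-1}` at `e_i`.
If all coordinates are at most 1, one of size `t^{1/(q-1)}` may therefore be chosen, and it
contributes only `t^p` to `‖z‖^q`. If (b) fails, `∑ t^p` converges over the good steps for some `ε`
(`exists_summable_of_not_subsequenceCondition`). The element `f` consists of `N` ones, which are
never chosen, and one coordinate of that size for each good step. At a bad step some error is large
enough for an old coordinate to be chosen again (`exists_wasted_step`). If (a) fails, a large `η'_n`
or `η_n` puts an already removed coordinate back into the residual infinitely often. -/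

/-- Write `|c|^q = (c^2)^{q/2}`. As `q/2 ≤ 1`, concavity and subadditivity of `s^{q/2}` reduce the
claim to the parallelogram identity in the line. -/
theorem abs_add_rpow_add_abs_sub_rpow_le {q : ℝ} (hq : 1 < q) (hq2 : q ≤ 2) (a b : ℝ) :
    |a + b| ^ q + |a - b| ^ q ≤ 2 * (|a| ^ q + |b| ^ q) := by
  have key : ∀ c : ℝ, |c| ^ q = (c ^ 2) ^ (q / 2) := fun c => by
    rw [← sq_abs, ← Real.rpow_natCast, ← Real.rpow_mul (abs_nonneg c)]
    congr 1
    push_cast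
    ring
  have hconc := (Real.concaveOn_rpow (p := q / 2) (by linarith) (by linarith)).2
    (Set.mem_Ici.2 (sq_nonneg (a + b))) (Set.mem_Ici.2 (sq_nonneg (a - b)))
    (by norm_num : (0 : ℝ) ≤ 1 / 2) (by norm_num : (0 : ℝ) ≤ 1 / 2) (by norm_num)
  have hsub := Real.rpow_add_le_add_rpow (sq_nonneg a) (sq_nonneg b)
    (by linarith : 0 ≤ q / 2) (by linarith)
  have hmid : (1 / 2 : ℝ) • (a + b) ^ 2 + (1 / 2 : ℝ) • (a - b) ^ 2 = a ^ 2 + b ^ 2 := by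
    simp only [smul_eq_mul]
    ring
  rw [hmid] at hconc
  simp only [smul_eq_mul] at hconc
  rw [key, key, key, key]
  linarith

theorem modulusOfSmoothness_nonneg (X : Type u) [NormedAddCommGroup X] [NormedSpace ℝ X] (u : ℝ) :
    0 ≤ modulusOfSmoothness X u := by
  refine Real.sSup_nonneg ?_
  rintro r ⟨x, y, hx, -, rfl⟩
  have h := norm_add_le (x + u • y) (x - u • y)
  have h2 : x + u • y + (x - u • y) = (2 : ℝ) • x := by rw [two_smul]; abel
  rw [h2, norm_smul, hx] at h
  norm_num at h
  linarith

theorem ellq_hasSum_norm {q : ℝ} (hq : 1 < q) (x : ellq q) : HasSum (fun i => |x i| ^ q) (‖x‖ ^ q) := by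
  have h := lp.hasSum_norm (p := ENNReal.ofReal q)
    (by rw [ENNReal.toReal_ofReal] <;> linarith) x
  rwa [ENNReal.toReal_ofReal (by linarith)] at h

theorem ellq_norm_add_rpow_add_norm_sub_rpow_le {q : ℝ} (hq : 1 < q) (hq2 : q ≤ 2)
    (x y : ellq q) :
    ‖x + y‖ ^ q + ‖x - y‖ ^ q ≤ 2 * (‖x‖ ^ q + ‖y‖ ^ q) :=
  hasSum_le (fun i => abs_add_rpow_add_abs_sub_rpow_le hq hq2 (x i) (y i))
    ((ellq_hasSum_norm hq (x + y)).add (ellq_hasSum_norm hq (x - y)))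
    (((ellq_hasSum_norm hq x).add (ellq_hasSum_norm hq y)).mul_left 2)

section EllQ

variable {q : ℝ} [Fact (1 ≤ ENNReal.ofReal q)]

/-- By convexity of `s^q` the mean `m` of the two norms satisfies `m^q ≤ 1 + |u|^q ≤ (1 + |u|^q)^q`.
-/
theorem ellq_modulusOfSmoothness_le (hq : 1 < q) (hq2 : q ≤ 2) (u : ℝ) :
    modulusOfSmoothness (ellq q) u ≤ |u| ^ q := by
  refine Real.sSup_le ?_ (by positivity)
  rintro r ⟨x, y, hx, hy, rfl⟩
  have h1 := ellq_norm_add_rpow_add_norm_sub_rpow_le hq hq2 x (u • y)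
  rw [norm_smul, hx, hy, Real.norm_eq_abs, mul_one, Real.one_rpow] at h1
  have h2 := (convexOn_rpow hq.le).2 (Set.mem_Ici.2 (norm_nonneg (x + u • y)))
    (Set.mem_Ici.2 (norm_nonneg (x - u • y)))
    (by norm_num : (0 : ℝ) ≤ 1 / 2) (by norm_num : (0 : ℝ) ≤ 1 / 2) (by norm_num)
  simp only [smul_eq_mul] at h2
  have hu : 1 ≤ 1 + |u| ^ q := by linarith [Real.rpow_nonneg (abs_nonneg u) q]
  have h3 : (1 / 2 * ‖x + u • y‖ + 1 / 2 * ‖x - u • y‖) ^ q ≤ (1 + |u| ^ q) ^ q := by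
    refine le_trans ?_ (Real.self_le_rpow_of_one_le hu hq.le)
    linarith
  have h4 := (Real.rpow_le_rpow_iff (by positivity) (by positivity) (by linarith)).1 h3
  linarith

theorem ellq_inClassP (hq : 1 < q) (hq2 : q ≤ 2) : InClassP q (ellq q) := by
  refine ⟨?_, 1, one_pos, fun u hu => ?_⟩
  · have hlim : Tendsto (fun u : ℝ => |u| ^ (q - 1)) (𝓝[≠] 0) (𝓝 0) := by
      have hc : ContinuousAt (fun u : ℝ => |u| ^ (q - 1)) 0 :=
        continuous_abs.continuousAt.rpow_const (Or.inr (by linarith))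
      have := hc.tendsto.mono_left (nhdsWithin_le_nhds (s := {0}ᶜ))
      simpa [Real.zero_rpow (by linarith : q - 1 ≠ 0)] using this
    refine Asymptotics.isLittleO_iff.2 fun c hc => ?_
    filter_upwards [hlim.eventually (ge_mem_nhds hc), self_mem_nhdsWithin] with u hu hu0
    have hpos : 0 < |u| := abs_pos.2 hu0
    rw [Real.norm_of_nonneg (modulusOfSmoothness_nonneg _ u), Real.norm_eq_abs]
    calc modulusOfSmoothness (ellq q) u ≤ |u| ^ q := ellq_modulusOfSmoothness_le hq hq2 u
      _ = |u| ^ (q - 1) * |u| := by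
        rw [Real.rpow_sub_one hpos.ne', div_mul_cancel₀ _ hpos.ne']
      _ ≤ c * |u| := by gcongr
  · simpa [abs_of_pos hu] using ellq_modulusOfSmoothness_le hq hq2 u

theorem isDictionary_canonicalDictionary (hq : 1 < q) :
    IsDictionary (canonicalDictionary q) := by
  have hpos : 0 < ENNReal.ofReal q := ENNReal.ofReal_pos.2 (by linarith)
  refine ⟨?_, ?_, ?_⟩
  · rintro g ⟨i, rfl | rfl⟩
    · rw [lp.norm_single hpos, norm_one]
    · rw [norm_neg, lp.norm_single hpos, norm_one]
  · rintro g ⟨i, rfl | rfl⟩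
    · exact ⟨i, Or.inr rfl⟩
    · exact ⟨i, Or.inl (neg_neg _)⟩
  · refine eq_top_iff.2 fun x _ => ?_
    have h := lp.hasSum_single (p := ENNReal.ofReal q) ENNReal.ofReal_ne_top x
    refine mem_closure_of_tendsto h (Eventually.of_forall fun s => ?_)
    refine Submodule.sum_mem _ fun i _ => ?_
    have h1 : lp.single (E := fun _ : ℕ => ℝ) (ENNReal.ofReal q) i (x i)
        = x i • lp.single (E := fun _ : ℕ => ℝ) (ENNReal.ofReal q) i (1 : ℝ) := by
      rw [← lp.single_smul, smul_eq_mul, mul_one]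
    rw [h1]
    exact Submodule.smul_mem _ _ (Submodule.subset_span ⟨i, Or.inl rfl⟩)

end EllQ

/-! ### Transfer along linear isometries -/

section Transfer

universe v

variable {X : Type u} [NormedAddCommGroup X] [NormedSpace ℝ X]
  {Y : Type v} [NormedAddCommGroup Y] [NormedSpace ℝ Y]

theorem modulusOfSmoothness_congr (e : X ≃ₗᵢ[ℝ] Y) :
    modulusOfSmoothness Y = modulusOfSmoothness X := by
  funext u
  unfold modulusOfSmoothness
  congr 1
  ext r
  constructor
  · rintro ⟨x, y, hx, hy, rfl⟩
    refine ⟨e.symm x, e.symm y, by simpa, by simpa, ?_⟩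
    simp only [← map_smul, ← map_add, ← map_sub, e.symm.norm_map]
  · rintro ⟨x, y, hx, hy, rfl⟩
    refine ⟨e x, e y, by simpa, by simpa, ?_⟩
    simp only [← map_smul, ← map_add, ← map_sub, e.norm_map]

theorem InClassP.congr (e : X ≃ₗᵢ[ℝ] Y) {q : ℝ} (h : InClassP q X) : InClassP q Y := by
  unfold InClassP IsUniformlySmooth at *
  rwa [modulusOfSmoothness_congr e]

theorem IsDictionary.image (e : X ≃ₗᵢ[ℝ] Y) {D : Set X} (h : IsDictionary D) : IsDictionary (e '' D) := by
  refine ⟨?_, ?_, ?_⟩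
  · rintro _ ⟨g, hg, rfl⟩
    rw [e.norm_map, h.norm_eq_one g hg]
  · rintro _ ⟨g, hg, rfl⟩
    exact ⟨-g, h.neg_mem g hg, map_neg e g⟩
  · refine eq_top_iff.2 fun y _ => ?_
    have hx : e.symm y ∈ closure (Submodule.span ℝ D : Set X) := by
      have : e.symm y ∈ (Submodule.span ℝ D).topologicalClosure := by
        rw [h.dense_span]; trivial
      exact this
    have hy := image_closure_subset_closure_image e.continuous ⟨_, hx, rfl⟩
    rw [e.apply_symm_apply] at hy
    refine closure_mono ?_ hy
    rintro _ ⟨x, hx, rfl⟩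
    have : e x ∈ (Submodule.span ℝ D).map (e.toLinearEquiv : X →ₗ[ℝ] Y) := ⟨x, hx, rfl⟩
    rwa [Submodule.map_span] at this

theorem approxSpace_comp (e : X ≃ₗᵢ[ℝ] Y) (φ : ℕ → X) (n : ℕ) :
    approxSpace (fun m => e (φ m)) n
      = (approxSpace φ n).map (e.toLinearEquiv : X →ₗ[ℝ] Y) := by
  unfold approxSpace
  rw [Submodule.map_span, ← Set.image_comp]
  rfl

theorem bestError_comp (e : X ≃ₗᵢ[ℝ] Y) (f : X) (φ : ℕ → X) (n : ℕ) :
    bestError (e f) (fun m => e (φ m)) n = bestError f φ n := by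
  unfold bestError
  rw [approxSpace_comp]
  refine (Equiv.iInf_congr ((e.toLinearEquiv.submoduleMap (approxSpace φ n)).toEquiv)
    fun G => ?_).symm
  change ‖e f - e (G : X)‖ = _
  rw [← map_sub, e.norm_map]

theorem Diverges.congr (e : X ≃ₗᵢ[ℝ] Y) {P : Parameters} {D : Set X} {f : X} (h : Diverges P D f) :
    Diverges P (e '' D) (e f) := by
  obtain ⟨F, φ, G, hR, hG⟩ := h
  refine ⟨fun n => (F n).comp (e.symm.toContinuousLinearEquiv : Y →L[ℝ] X), fun n => e (φ n),
    fun n => e (G n), ?_, fun hlim => hG ?_⟩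
  · constructor
    · rw [hR.init, map_zero]
    · intro n
      refine ContinuousLinearMap.opNorm_le_bound _ zero_le_one fun y => ?_
      have := (F n).le_of_opNorm_le (hR.functional_norm n) (e.symm y)
      simpa using this
    · intro n
      have := hR.functional_apply n
      simpa [← map_sub] using this
    · exact fun n hn => ⟨_, hR.mem_dictionary n hn, rfl⟩
    · intro n hn
      have := hR.greedy n hn
      have h2 : (⨆ g : (e '' D : Set Y), F (n - 1) (e.symm (g : Y)))
          = ⨆ g : D, F (n - 1) (g : X) := by
        refine (Equiv.iSup_congr (Equiv.Set.image e D e.injective) fun g => ?_).symm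
        simp
      simpa [h2] using this
    · intro n hn
      rw [approxSpace_comp]
      exact ⟨_, hR.mem_approxSpace n hn, rfl⟩
    · intro n hn
      rw [bestError_comp, ← map_sub, e.norm_map]
      exact hR.approx n hn
  · have := (e.symm.continuous.tendsto (e f)).comp hlim
    simpa [Function.comp_def] using this

end Transfer

/-! ### Sufficiency of the conditions -/

theorem exists_pos_mul_rpow_le {s : ℝ} (hs : 0 < s) (M : ℝ) {ε : ℝ} (hε : 0 < ε) :
    ∃ μ : ℝ, 0 < μ ∧ μ ≤ 1 ∧ M * μ ^ s ≤ ε := by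
  have hc : Tendsto (fun μ : ℝ => M * μ ^ s) (𝓝 0) (𝓝 0) := by
    have := ((Real.continuousAt_rpow_const 0 s (Or.inr hs.le)).tendsto).const_mul M
    simpa [Real.zero_rpow hs.ne'] using this
  obtain ⟨μ, h1, h2, h3⟩ := (((hc.mono_left nhdsWithin_le_nhds).eventually
    (ge_mem_nhds hε)).and (Ioc_mem_nhdsGT (zero_lt_one' ℝ))).exists
  exact ⟨μ, h2, h3, h1⟩

section Sufficiency

variable {X : Type u} [NormedAddCommGroup X] [NormedSpace ℝ X]

theorem le_modulusOfSmoothness {x y : X} (hx : ‖x‖ = 1) (hy : ‖y‖ = 1) (u : ℝ) :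
    (‖x + u • y‖ + ‖x - u • y‖) / 2 - 1 ≤ modulusOfSmoothness X u := by
  refine le_csSup ⟨|u|, ?_⟩ ⟨x, y, hx, hy, rfl⟩
  rintro r ⟨a, b, ha, hb, rfl⟩
  have h1 := norm_add_le a (u • b)
  have h2 := norm_sub_le a (u • b)
  rw [norm_smul, ha, hb, mul_one, Real.norm_eq_abs] at h1 h2
  linarith

/-- Normalizing both vectors gives an error `2γ‖x‖^{1-q}‖y‖^q`; as `1 - q < 0`, a lower bound on
`‖x‖` makes the constant uniform. -/
theorem InClassP.exists_norm_add_add_norm_sub_le {q : ℝ} (hq : 1 < q) (h : InClassP q X)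
    {α : ℝ} (hα : 0 < α) :
    ∃ K : ℝ, 0 < K ∧ ∀ x y : X, α ≤ ‖x‖ → ‖x + y‖ + ‖x - y‖ ≤ 2 * ‖x‖ + K * ‖y‖ ^ q := by
  obtain ⟨-, γ, hγ, hρ⟩ := h
  refine ⟨2 * γ * α ^ (1 - q), by positivity, fun x y hx => ?_⟩
  have hx0 : 0 < ‖x‖ := hα.trans_le hx
  rcases eq_or_ne y 0 with rfl | hy
  · simp only [add_zero, sub_zero, norm_zero, Real.zero_rpow (by linarith : q ≠ 0), mul_zero]
    linarith
  have hy0 : 0 < ‖y‖ := norm_pos_iff.2 hy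
  set u : ℝ := ‖y‖ / ‖x‖ with hu
  have hu0 : 0 < u := div_pos hy0 hx0
  have h1 := (le_modulusOfSmoothness (x := ‖x‖⁻¹ • x) (y := ‖y‖⁻¹ • y)
    (by rw [norm_smul, norm_inv, norm_norm, inv_mul_cancel₀ hx0.ne'])
    (by rw [norm_smul, norm_inv, norm_norm, inv_mul_cancel₀ hy0.ne']) u).trans (hρ u hu0)
  have h2 : u • ‖y‖⁻¹ • y = ‖x‖⁻¹ • y := by
    rw [smul_smul]
    congr 1
    rw [hu]
    field_simp
  rw [h2, ← smul_add, ← smul_sub, norm_smul, norm_smul, norm_inv, norm_norm] at h1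
  have h3 : ‖x + y‖ + ‖x - y‖ ≤ 2 * ‖x‖ + 2 * γ * (‖x‖ * u ^ q) := by
    have h4 := mul_le_mul_of_nonneg_left h1 hx0.le
    have h5 : ‖x‖ * ((‖x‖⁻¹ * ‖x + y‖ + ‖x‖⁻¹ * ‖x - y‖) / 2 - 1)
        = (‖x + y‖ + ‖x - y‖) / 2 - ‖x‖ := by field_simp
    rw [h5] at h4
    linarith
  have h6 : ‖x‖ * u ^ q = ‖x‖ ^ (1 - q) * ‖y‖ ^ q := by
    rw [hu, Real.div_rpow hy0.le hx0.le, Real.rpow_sub hx0, Real.rpow_one]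
    ring
  have h7 : ‖x‖ ^ (1 - q) ≤ α ^ (1 - q) :=
    Real.rpow_le_rpow_of_nonpos hα hx (by linarith)
  rw [h6] at h3
  refine h3.trans ?_
  have : 2 * γ * (‖x‖ ^ (1 - q) * ‖y‖ ^ q) ≤ 2 * γ * (α ^ (1 - q) * ‖y‖ ^ q) := by gcongr
  linarith

theorem bestError_le {f : X} {φ : ℕ → X} {n : ℕ} {G : X} (hG : G ∈ approxSpace φ n) :
    bestError f φ n ≤ ‖f - G‖ :=
  ciInf_le (f := fun G : approxSpace φ n => ‖f - (G : X)‖)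
    ⟨0, by rintro _ ⟨G, rfl⟩; exact norm_nonneg _⟩ ⟨G, hG⟩

theorem bestError_nonneg (f : X) (φ : ℕ → X) (n : ℕ) : 0 ≤ bestError f φ n :=
  Real.iInf_nonneg fun _ => norm_nonneg _

theorem bestError_le_norm (f : X) (φ : ℕ → X) (n : ℕ) : bestError f φ n ≤ ‖f‖ := by
  simpa using bestError_le (f := f) (φ := φ) (n := n) (Submodule.zero_mem _)

theorem approxSpace_mono (φ : ℕ → X) : Monotone (approxSpace φ) := fun _ _ h =>
  Submodule.span_mono (Set.image_mono (Set.Icc_subset_Icc_right h))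

theorem bestError_antitone (f : X) (φ : ℕ → X) : Antitone (bestError f φ) := fun _ _ h =>
  le_ciInf fun G => bestError_le (approxSpace_mono φ h G.2)

theorem IsDictionary.bddAbove {D : Set X} (hD : IsDictionary D) (F : X →L[ℝ] ℝ) :
    BddAbove (Set.range fun g : D => F (g : X)) := by
  refine ⟨‖F‖, ?_⟩
  rintro _ ⟨g, rfl⟩
  have := F.le_opNorm (g : X)
  rw [hD.norm_eq_one _ g.2, mul_one] at this
  exact (le_abs_self _).trans this

/-- `A` is the sum of the absolute coefficients in a representation of `h`, so it does not depend on
`F`. Symmetry of the dictionary supplies the absolute value. -/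
theorem IsDictionary.exists_abs_apply_le {D : Set X} (hD : IsDictionary D) {h : X}
    (hh : h ∈ Submodule.span ℝ D) :
    ∃ A : ℝ, 0 ≤ A ∧ ∀ F : X →L[ℝ] ℝ, |F h| ≤ A * ⨆ g : D, F (g : X) := by
  induction hh using Submodule.span_induction with
  | mem x hx =>
    refine ⟨1, zero_le_one, fun F => ?_⟩
    rw [one_mul]
    refine abs_le'.2 ⟨le_ciSup (hD.bddAbove F) ⟨x, hx⟩, ?_⟩
    rw [← map_neg]
    exact le_ciSup (hD.bddAbove F) ⟨-x, hD.neg_mem x hx⟩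
  | zero => exact ⟨0, le_rfl, fun F => by simp⟩
  | add x y _ _ hx hy =>
    obtain ⟨A, hA, hx⟩ := hx
    obtain ⟨B, hB, hy⟩ := hy
    refine ⟨A + B, add_nonneg hA hB, fun F => ?_⟩
    rw [map_add, add_mul]
    exact (abs_add_le _ _).trans (add_le_add (hx F) (hy F))
  | smul c x _ hx =>
    obtain ⟨A, hA, hx⟩ := hx
    refine ⟨|c| * A, by positivity, fun F => ?_⟩
    rw [map_smul, smul_eq_mul, abs_mul, mul_assoc]
    exact mul_le_mul_of_nonneg_left (hx F) (abs_nonneg c)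

/-- Bounding `‖x + y‖` below by `F x + F y` turns the two-sided smoothness estimate into a one-sided
one for `‖x - y‖`. -/
theorem norm_sub_add_apply_le {x : X} {F : X →L[ℝ] ℝ} {δ δ' K q : ℝ} (hF : ‖F‖ ≤ 1)
    (hFx : (1 - δ) * ‖x‖ - δ' ≤ F x) (y : X)
    (hK : ‖x + y‖ + ‖x - y‖ ≤ 2 * ‖x‖ + K * ‖y‖ ^ q) :
    ‖x - y‖ + F y ≤ ‖x‖ + (δ * ‖x‖ + δ') + K * ‖y‖ ^ q := by
  have h1 := (le_abs_self _).trans (F.le_of_opNorm_le hF (x + y))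
  rw [map_add, one_mul] at h1
  linarith

/-- If the residuals stay away from zero and all errors are small, an approximately norming
functional of the residual is bounded from below on the dictionary. -/
theorem le_apply_of_small_errors {f G h : X} {V : Submodule ℝ X} {F : X →L[ℝ] ℝ}
    {α E δ δ' K q σ μ L : ℝ} (hq : 1 < q) (hG : G ∈ V) (hE : ∀ y ∈ V, E ≤ ‖f - y‖)
    (hαE : α ≤ E) (hF : ‖F‖ ≤ 1) (hFx : (1 - δ) * ‖f - G‖ - δ' ≤ F (f - G))
    (hK0 : 0 ≤ K)
    (hK : ∀ y : X, ‖f - G + y‖ + ‖f - G - y‖ ≤ 2 * ‖f - G‖ + K * ‖y‖ ^ q)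
    (hσ : ‖f - G‖ - E + (δ * ‖f - G‖ + δ') ≤ σ) (hGL : ‖G‖ ≤ L) (hμ0 : 0 < μ) (hμ1 : μ ≤ 1)
    (hμ : K * L ^ q * μ ^ (q - 1) ≤ α / 8) (hσμ : σ ≤ α / 8 * μ) (hα : 0 < α)
    (hh : ‖f - h‖ ≤ α / 8) : α / 2 ≤ F h := by
  -- Moving by a multiple of `G` stays in `f - V`, where the norm is at least `E`; this prevents `F
  -- G` from being very negative.
  have h1 := norm_sub_add_apply_le hF hFx (-(μ • G)) (hK _)
  have h2 : E ≤ ‖f - G - -(μ • G)‖ := by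
    have := hE (G - μ • G) (V.sub_mem hG (V.smul_mem μ hG))
    rwa [show f - (G - μ • G) = f - G - -(μ • G) by abel] at this
  rw [map_neg, map_smul, smul_eq_mul, norm_neg, norm_smul, Real.norm_of_nonneg hμ0.le,
    Real.mul_rpow hμ0.le (norm_nonneg G)] at h1
  have h3 : K * (μ ^ q * ‖G‖ ^ q) ≤ α / 8 * μ := by
    have e1 : μ ^ q = μ ^ (q - 1) * μ := by
      rw [Real.rpow_sub_one hμ0.ne', div_mul_cancel₀ _ hμ0.ne']
    have e2 : ‖G‖ ^ q ≤ L ^ q := Real.rpow_le_rpow (norm_nonneg _) hGL (by linarith)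
    calc K * (μ ^ q * ‖G‖ ^ q) ≤ K * (μ ^ q * L ^ q) := by gcongr
      _ = K * L ^ q * μ ^ (q - 1) * μ := by rw [e1]; ring
      _ ≤ α / 8 * μ := by gcongr
  have h4 : -(α / 4) ≤ F G := by
    have : μ * (-(α / 4)) ≤ μ * F G := by linarith
    exact le_of_mul_le_mul_left this hμ0
  have h5 : F (f - h) ≤ α / 8 := by
    have := (le_abs_self _).trans (F.le_of_opNorm_le hF (f - h))
    linarith
  have hEG := hE G hG
  have h6 : σ ≤ α / 8 := hσμ.trans (by nlinarith)
  rw [map_sub] at h5 hFx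
  linarith

/-- The decrease of the best error in one step of the algorithm. -/
theorem bestError_succ_le {f G : X} {φ : ℕ → X} {n : ℕ} {F : X →L[ℝ] ℝ}
    {δ δ' K q p σ κ c t : ℝ} (hq : 1 < q) (hp : p = q / (q - 1)) (hG : G ∈ approxSpace φ n)
    (hφ : ‖φ (n + 1)‖ = 1) (hF : ‖F‖ ≤ 1) (hFx : (1 - δ) * ‖f - G‖ - δ' ≤ F (f - G))
    (hK : ∀ y : X, ‖f - G + y‖ + ‖f - G - y‖ ≤ 2 * ‖f - G‖ + K * ‖y‖ ^ q)
    (hσ : ‖f - G‖ - bestError f φ n + (δ * ‖f - G‖ + δ') ≤ σ) (ht : 0 ≤ t) (hκ : 0 < κ)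
    (hFφ : t * c ≤ F (φ (n + 1))) (hκc : K * κ ^ (q - 1) ≤ c / 4)
    (hσt : σ ≤ κ * c / 4 * t ^ p) :
    bestError f φ (n + 1) ≤ bestError f φ n - κ * c / 2 * t ^ p := by
  have hq1 : q - 1 ≠ 0 := by linarith
  -- This power of `t` makes both `l * t` and `l ^ q` multiples of `t ^ p`.
  set l : ℝ := κ * t ^ (1 / (q - 1)) with hl
  have hl0 : 0 ≤ l := by positivity
  have h1 := norm_sub_add_apply_le hF hFx (l • φ (n + 1)) (hK _)
  rw [map_smul, smul_eq_mul, norm_smul, hφ, mul_one, Real.norm_of_nonneg hl0] at h1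
  have h2 : bestError f φ (n + 1) ≤ ‖f - G - l • φ (n + 1)‖ := by
    rw [sub_sub]
    refine bestError_le (Submodule.add_mem _ (approxSpace_mono φ n.le_succ hG) ?_)
    exact Submodule.smul_mem _ _ (Submodule.subset_span ⟨n + 1, ⟨by omega, le_rfl⟩, rfl⟩)
  have h3 : l ^ q = κ ^ (q - 1) * κ * t ^ p := by
    rw [hl, Real.mul_rpow hκ.le (by positivity), ← Real.rpow_mul ht,
      Real.rpow_sub_one hκ.ne', div_mul_cancel₀ _ hκ.ne', hp]
    congr 2
    field_simp
  have h4 : l * t = κ * t ^ p := by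
    rw [hl, mul_assoc]
    congr 1
    rcases ht.eq_or_lt with rfl | ht0
    · rw [mul_zero, Real.zero_rpow]
      rw [hp]
      exact (div_pos (by linarith) (by linarith)).ne'
    · rw [← Real.rpow_add_one ht0.ne', hp]
      congr 1
      field_simp
      ring
  have h5 : K * l ^ q ≤ κ * c / 4 * t ^ p := by
    have : 0 ≤ κ * t ^ p := by positivity
    calc K * l ^ q = K * κ ^ (q - 1) * (κ * t ^ p) := by rw [h3]; ring
      _ ≤ c / 4 * (κ * t ^ p) := by gcongr
      _ = κ * c / 4 * t ^ p := by ring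
  have h6 : κ * c * t ^ p ≤ l * F (φ (n + 1)) := by
    calc κ * c * t ^ p = l * (t * c) := by rw [← mul_assoc, h4]; ring
      _ ≤ l * F (φ (n + 1)) := by gcongr
  linarith

theorem tendsto_of_bestError_tendsto {P : Parameters} {D : Set X} {f : X} {F : ℕ → (X →L[ℝ] ℝ)}
    {φ G : ℕ → X} (hR : IsRealization P D f F φ G) (hE : ErrorCondition P)
    (h : Tendsto (bestError f φ) atTop (𝓝 0)) : Tendsto G atTop (𝓝 f) := by
  obtain ⟨⟨C, hC⟩, hη'⟩ := hE
  have hlim : Tendsto (fun n => (1 + C) * bestError f φ n + P.η' n) atTop (𝓝 0) := by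
    simpa using (h.const_mul (1 + C)).add hη'
  have h2 : Tendsto (fun n => f - G n) atTop (𝓝 0) := by
    refine squeeze_zero_norm' ?_ hlim
    filter_upwards [eventually_ge_atTop 1] with n hn
    have := hC ⟨n, hn, rfl⟩
    refine (hR.approx n hn).trans ?_
    have := bestError_nonneg f φ n
    gcongr
  simpa using h2.const_sub f

/-- Telescoping: the drops at the steps `n k` add up to at most the initial value of `E`, since `E`
does not increase in between. -/
theorem not_tendsto_sum_of_antitone {E : ℕ → ℝ} (hE : Antitone E) (h0 : ∀ n, 0 ≤ E n)
    {n : ℕ → ℕ} (hn : StrictMono n) {a : ℕ → ℝ} {c : ℝ} (hc : 0 < c)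
    (h : ∀ᶠ k in atTop, E (n k + 1) ≤ E (n k) - c * a k) :
    ¬ Tendsto (fun N => ∑ k ∈ Finset.range N, a k) atTop atTop := by
  intro hT
  obtain ⟨K, hK⟩ := eventually_atTop.1 h
  have hb : ∀ N, K ≤ N →
      c * ∑ k ∈ Finset.range N, a k ≤ c * ∑ k ∈ Finset.range K, a k + E (n K) - E (n N) := by
    intro N hN
    induction N, hN using Nat.le_induction with
    | base => linarith
    | succ N hN ih =>
      rw [Finset.sum_range_succ]
      have h1 := hK N hN
      have h2 : E (n (N + 1)) ≤ E (n N + 1) := hE (hn N.lt_succ_self)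
      linarith
  obtain ⟨N, hN1, hN2⟩ := ((hT.const_mul_atTop hc).eventually
    (eventually_gt_atTop (c * ∑ k ∈ Finset.range K, a k + E (n K)))|>.and
      (eventually_ge_atTop K)).exists
  linarith [hb N hN2, h0 (n N)]

theorem converges_of_conditions {q p : ℝ} (hq : 1 < q) (hp : p = q / (q - 1)) {P : Parameters}
    (hE : ErrorCondition P) (hS : SubsequenceCondition p P) (hX : InClassP q X) {D : Set X}
    (hD : IsDictionary D) (f : X) : Converges P D f := by
  intro F φ G hR
  refine tendsto_of_bestError_tendsto hR hE ?_
  by_contra hnot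
  have hanti := bestError_antitone f φ
  obtain ⟨α, hα, hαE⟩ : ∃ α : ℝ, 0 < α ∧ ∀ n, α ≤ bestError f φ n := by
    by_contra! hcon
    refine hnot (tendsto_order.2 ⟨fun a ha => Eventually.of_forall fun n =>
      ha.trans_le (bestError_nonneg f φ n), fun a ha => ?_⟩)
    obtain ⟨N, hN⟩ := hcon a ha
    filter_upwards [eventually_ge_atTop N] with n hn using (hanti hn).trans_lt hN
  obtain ⟨K, hK0, hK⟩ := hX.exists_norm_add_add_norm_sub_le hq hα
  obtain ⟨h, hhD, hh⟩ : ∃ h ∈ Submodule.span ℝ D, ‖f - h‖ ≤ α / 8 := by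
    have hf : f ∈ closure (Submodule.span ℝ D : Set X) := by
      have : f ∈ (Submodule.span ℝ D).topologicalClosure := by rw [hD.dense_span]; trivial
      exact this
    obtain ⟨h, hh, hd⟩ := Metric.mem_closure_iff.1 hf (α / 8) (by positivity)
    exact ⟨h, hh, by rw [← dist_eq_norm]; exact hd.le⟩
  obtain ⟨A, hA0, hA⟩ := hD.exists_abs_apply_le hhD
  -- Bounds the residual wherever `η` and `η'` are at most 1.
  set R : ℝ := 2 * ‖f‖ + 1 with hRdef
  have hR1 : 0 ≤ R := by positivity
  obtain ⟨μ, hμ0, hμ1, hμ⟩ := exists_pos_mul_rpow_le (s := q - 1) (by linarith)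
    (K * (‖f‖ + R) ^ q) (by positivity : 0 < α / 8)
  -- Half of the lower bound for the supremum of `F` over `D`; the other half absorbs `t'`.
  set c : ℝ := α / (2 * (A + 1)) / 2 with hc
  have hc0 : 0 < c := by positivity
  obtain ⟨κ, hκ0, -, hκ⟩ := exists_pos_mul_rpow_le (s := q - 1) (by linarith) K
    (by positivity : 0 < c / 4)
  have hp0 : 0 < p := hp ▸ div_pos (by linarith) (by linarith)
  obtain ⟨n, hn, hn1, hsum, ht', hδ, hδ', hη, hη'⟩ := hS
  have htn : ∀ k, 0 ≤ P.t (n k + 1) := fun k => P.t_nonneg _ (by omega)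
  have htp : ∀ k, P.t (n k + 1) ^ p ≤ 1 := fun k =>
    Real.rpow_le_one (htn k) (P.t_le_one _ (by omega)) hp0.le
  set σ : ℕ → ℝ := fun k => ‖f‖ * P.η (n k) + P.η' (n k) + (R * P.δ (n k) + P.δ' (n k)) with hσ
  have hσo : σ =o[atTop] (fun k => P.t (n k + 1) ^ p) :=
    ((hη.const_mul_left ‖f‖).add hη').add ((hδ.const_mul_left R).add hδ')
  have ev : ∀ {a : ℕ → ℝ}, a =o[atTop] (fun k => P.t (n k + 1) ^ p) → ∀ ε : ℝ, 0 < ε →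
      ∀ᶠ k in atTop, a k ≤ ε * P.t (n k + 1) ^ p := fun ha ε hε => by
    filter_upwards [isLittleO_iff.1 ha hε] with k hk
    rw [Real.norm_of_nonneg (Real.rpow_nonneg (htn k) p)] at hk
    exact (le_abs_self _).trans hk
  refine not_tendsto_sum_of_antitone hanti (bestError_nonneg f φ) hn (a := fun k =>
    P.t (n k + 1) ^ p) (c := κ * c / 2) (by positivity) ?_ hsum
  filter_upwards [ev hη 1 one_pos, ev hη' 1 one_pos, ev hσo (α / 8 * μ) (by positivity),
    ev hσo (κ * c / 4) (by positivity), isLittleO_iff.1 ht' hc0] with k k1 k2 k3 k4 k5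
  have htk := htp k
  have hαk := hαE (n k)
  have hek := bestError_le_norm f φ (n k)
  have hηk := P.η_nonneg (n k) (hn1 k)
  have hδk := P.δ_nonneg (n k)
  have happ := hR.approx (n k) (hn1 k)
  have hGV := hR.mem_approxSpace (n k) (hn1 k)
  have hxR : ‖f - G (n k)‖ ≤ R := by
    refine happ.trans ?_
    have : (1 + P.η (n k)) * bestError f φ (n k) ≤ (1 + 1) * ‖f‖ := by
      have := bestError_nonneg f φ (n k)
      gcongr
      linarith
    linarith
  have hσk : ‖f - G (n k)‖ - bestError f φ (n k) + (P.δ (n k) * ‖f - G (n k)‖ + P.δ' (n k))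
      ≤ σ k := by
    have e1 : P.η (n k) * bestError f φ (n k) ≤ P.η (n k) * ‖f‖ := by gcongr
    have e2 : P.δ (n k) * ‖f - G (n k)‖ ≤ P.δ (n k) * R := by gcongr
    simp only [hσ]
    linarith
  have hx : α ≤ ‖f - G (n k)‖ := hαk.trans (bestError_le hGV)
  have hsup : α / 2 ≤ F (n k) h := by
    refine le_apply_of_small_errors hq hGV (fun y hy => bestError_le hy) hαk
      (hR.functional_norm _) (hR.functional_apply _) hK0.le (fun y => hK _ y hx) hσk ?_ hμ0 hμ1
      hμ (k3.trans (mul_le_of_le_one_right (by positivity) htk)) hα hh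
    have := norm_sub_le f (f - G (n k))
    rw [sub_sub_cancel] at this
    linarith
  have hs : 2 * c ≤ ⨆ g : D, F (n k) (g : X) := by
    have h1 := hsup.trans ((le_abs_self _).trans (hA (F (n k))))
    have h2 : 0 < ⨆ g : D, F (n k) (g : X) := by
      by_contra! hle
      nlinarith
    have h3 : 2 * c = α / 2 / (A + 1) := by rw [hc]; field_simp
    rw [h3, div_le_iff₀ (by positivity)]
    nlinarith
  refine bestError_succ_le hq hp hGV
    (hD.norm_eq_one _ (hR.mem_dictionary _ (by omega))) (hR.functional_norm _)
    (hR.functional_apply _) (fun y => hK _ y hx) hσk (htn k) hκ0 ?_ hκ k4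
  have hgr := hR.greedy (n k + 1) (by omega)
  rw [Nat.add_sub_cancel] at hgr
  rw [Real.norm_of_nonneg (htn k)] at k5
  have k6 := (le_abs_self _).trans k5
  have := mul_le_mul_of_nonneg_left hs (htn k)
  linarith

end Sufficiency

/-! ### Failure of the subsequence condition -/

/-- The indices `n ≥ 1` at which all errors are at most `ε` times the comparison quantity of
the subsequence condition. -/
def goodSteps (p : ℝ) (P : Parameters) (ε : ℝ) : Set ℕ :=
  {n | 1 ≤ n ∧ P.t' (n + 1) ≤ ε * P.t (n + 1) ∧ P.δ n ≤ ε * P.t (n + 1) ^ p ∧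
    P.δ' n ≤ ε * P.t (n + 1) ^ p ∧ P.η n ≤ ε * P.t (n + 1) ^ p ∧
    P.η' n ≤ ε * P.t (n + 1) ^ p}

theorem Parameters.t_succ_nonneg (P : Parameters) (n : ℕ) : 0 ≤ P.t (n + 1) :=
  P.t_nonneg _ (by omega)

theorem Parameters.t_succ_le_one (P : Parameters) (n : ℕ) : P.t (n + 1) ≤ 1 :=
  P.t_le_one _ (by omega)

theorem goodSteps_mono (p : ℝ) (P : Parameters) {ε ε' : ℝ} (h : ε ≤ ε') :
    goodSteps p P ε ⊆ goodSteps p P ε' := by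
  rintro n ⟨h1, h2, h3, h4, h5, h6⟩
  have ht := mul_le_mul_of_nonneg_right h (P.t_succ_nonneg n)
  have htp := mul_le_mul_of_nonneg_right h (Real.rpow_nonneg (P.t_succ_nonneg n) p)
  exact ⟨h1, h2.trans ht, h3.trans htp, h4.trans htp, h5.trans htp, h6.trans htp⟩

/-- A diagonal choice: if the series `∑ g` diverges along every set of a sequence of sets, then
there is a set along which it diverges and whose tails lie in the tails of the sequence. -/
theorem exists_set_not_summable {g : ℕ → ℝ} (hg : ∀ n, 0 ≤ g n) {A : ℕ → Set ℕ}
    (hA : Antitone A) (h : ∀ k, ¬ Summable ((A k).indicator g)) :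
    ∃ S : Set ℕ, ¬ Summable (S.indicator g) ∧ S ⊆ A 0 ∧
      ∀ k, ∃ m, ∀ n ∈ S, m ≤ n → n ∈ A k := by
  have hnn : ∀ (S : Set ℕ) n, 0 ≤ S.indicator g n := fun S n =>
    Set.indicator_nonneg (fun n _ => hg n) n
  have hstep : ∀ k m, ∃ m', m < m' ∧ 1 ≤ ∑ i ∈ Finset.Ico m m', (A k).indicator g i := by
    intro k m
    have hT := (not_summable_iff_tendsto_nat_atTop_of_nonneg (hnn (A k))).1 (h k)
    obtain ⟨m', h1, h2⟩ := ((hT.eventually (eventually_ge_atTop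
      (1 + ∑ i ∈ Finset.range m, (A k).indicator g i))).and (eventually_gt_atTop m)).exists
    refine ⟨m', h2, ?_⟩
    rw [Finset.sum_Ico_eq_sub _ h2.le]
    linarith
  choose next hlt hone using hstep
  -- The blocks `[m k, m (k + 1))` each carry mass at least 1 on `A k`; the set `S` follows `A k` on
  -- the `k`-th block.
  let m : ℕ → ℕ := fun k => Nat.rec 0 (fun k m => next k m) k
  have hm : StrictMono m := strictMono_nat_of_lt_succ fun k => hlt k (m k)
  have hblock : ∀ k, 1 ≤ ∑ i ∈ Finset.Ico (m k) (m (k + 1)), (A k).indicator g i :=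
    fun k => hone k (m k)
  set S : Set ℕ := {n | ∃ k, m k ≤ n ∧ n < m (k + 1) ∧ n ∈ A k} with hS
  refine ⟨S, fun hsum => ?_, ?_, fun k => ⟨m k, ?_⟩⟩
  · have hk : ∀ k : ℕ, (k : ℝ) ≤ ∑ i ∈ Finset.range (m k), S.indicator g i := by
      intro k
      induction k with
      | zero => simpa using Finset.sum_nonneg fun i _ => hnn S i
      | succ k ih =>
        rw [← Finset.sum_range_add_sum_Ico _ (hm k.lt_succ_self).le]
        have : ∑ i ∈ Finset.Ico (m k) (m (k + 1)), (A k).indicator g i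
            ≤ ∑ i ∈ Finset.Ico (m k) (m (k + 1)), S.indicator g i := by
          refine Finset.sum_le_sum fun i hi => ?_
          rw [Finset.mem_Ico] at hi
          by_cases hiA : i ∈ A k
          · rw [Set.indicator_of_mem hiA, Set.indicator_of_mem (show i ∈ S from
              ⟨k, hi.1, hi.2, hiA⟩)]
          · rw [Set.indicator_of_notMem hiA]
            exact hnn S i
        push_cast
        linarith [hblock k]
    obtain ⟨k, hkt⟩ := exists_nat_gt (∑' i, S.indicator g i)
    linarith [hk k, hsum.sum_le_tsum (Finset.range (m k)) fun i _ => hnn S i]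
  · rintro n ⟨k, -, -, hn⟩
    exact hA k.zero_le hn
  · rintro n ⟨j, -, hj, hn⟩ hkn
    have : k < j + 1 := hm.lt_iff_lt.1 (hkn.trans_lt hj)
    exact hA (by omega) hn

/-- Otherwise the diagonal set for `ε = 1/(k+1)`, enumerated increasingly, would be a subsequence as
required in (b). -/
theorem exists_summable_of_not_subsequenceCondition {p : ℝ} {P : Parameters}
    (h : ¬ SubsequenceCondition p P) :
    ∃ ε : ℝ, 0 < ε ∧ Summable ((goodSteps p P ε).indicator fun n => P.t (n + 1) ^ p) := by
  by_contra! hcon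
  refine h ?_
  have hg : ∀ n, 0 ≤ P.t (n + 1) ^ p := fun n => Real.rpow_nonneg (P.t_succ_nonneg n) p
  have hA : Antitone fun k : ℕ => goodSteps p P (1 / ((k : ℝ) + 1)) := fun a b hab =>
    goodSteps_mono p P (one_div_le_one_div_of_le (by positivity) (by gcongr))
  obtain ⟨S, hS, hS0, hSk⟩ := exists_set_not_summable hg hA fun k => hcon _ (by positivity)
  have hinf : S.Infinite := fun hfin => hS (summable_of_hasFiniteSupport
    (hfin.subset Set.support_indicator_subset))
  have hinf' : {n | n ∈ S}.Infinite := hinf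
  have hmem : ∀ k, Nat.nth (· ∈ S) k ∈ S := fun k => Nat.nth_mem_of_infinite hinf' k
  have hmono := Nat.nth_strictMono hinf'
  have hev : ∀ ε : ℝ, 0 < ε → ∀ᶠ k in atTop, Nat.nth (· ∈ S) k ∈ goodSteps p P ε := by
    intro ε hε
    obtain ⟨K, hK⟩ := exists_nat_one_div_lt hε
    obtain ⟨m, hm⟩ := hSk K
    filter_upwards [eventually_ge_atTop m] with k hk
    exact goodSteps_mono p P hK.le (hm _ (hmem k) (hk.trans (hmono.id_le k)))
  refine ⟨Nat.nth (· ∈ S), hmono, fun k => (hS0 (hmem k)).1, ?_, ?_, ?_, ?_, ?_, ?_⟩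
  · refine (not_summable_iff_tendsto_nat_atTop_of_nonneg fun k => hg _).1 fun hsum => hS ?_
    refine (hmono.injective.summable_iff (f := S.indicator fun n => P.t (n + 1) ^ p)
      fun n hn => ?_).1 ?_
    · rw [Nat.range_nth_of_infinite hinf'] at hn
      exact Set.indicator_of_notMem hn _
    · refine hsum.congr fun k => ?_
      exact (Set.indicator_of_mem (hmem k) fun n => P.t (n + 1) ^ p).symm
  all_goals
    refine isLittleO_iff.2 fun c hc => ?_
    filter_upwards [hev c hc] with k hk
    obtain ⟨h1, h2, h3, h4, h5, h6⟩ := hk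
  · rwa [Real.norm_of_nonneg (P.t'_nonneg _ (by omega)), Real.norm_of_nonneg (P.t_succ_nonneg _)]
  · rwa [Real.norm_of_nonneg (P.δ_nonneg _), Real.norm_of_nonneg (hg _)]
  · rwa [Real.norm_of_nonneg (P.δ'_nonneg _), Real.norm_of_nonneg (hg _)]
  · rwa [Real.norm_of_nonneg (P.η_nonneg _ h1), Real.norm_of_nonneg (hg _)]
  · rwa [Real.norm_of_nonneg (P.η'_nonneg _ h1), Real.norm_of_nonneg (hg _)]

/-! ### Realizations in `ℓ_q` along coordinate vectors -/

/-- The canonical basis vector `e_i` of `ℓ_q`. -/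
noncomputable def basisVec (q : ℝ) (i : ℕ) : ellq q := lp.single (ENNReal.ofReal q) i (1 : ℝ)

theorem basisVec_apply (q : ℝ) (i j : ℕ) : basisVec q i j = if j = i then 1 else 0 := by
  unfold basisVec
  rw [lp.single_apply, Pi.single_apply]

/-- The vector `f` with its coordinates in `J` replaced by zero. -/
noncomputable def residual {q : ℝ} (f : ellq q) (J : Finset ℕ) : ellq q :=
  f - ∑ i ∈ J, f i • basisVec q i

theorem residual_apply {q : ℝ} (f : ellq q) (J : Finset ℕ) (j : ℕ) :
    residual f J j = if j ∈ J then 0 else f j := by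
  have h : (∑ i ∈ J, f i • basisVec q i : ellq q) j = if j ∈ J then f j else 0 := by
    rw [lp.coeFn_sum, Finset.sum_apply]
    simp [basisVec_apply]
  change f j - (∑ i ∈ J, f i • basisVec q i : ellq q) j = _
  rw [h]
  split_ifs <;> simp

theorem sub_residual_mem {q : ℝ} (f : ellq q) (J : Finset ℕ) :
    f - residual f J ∈ Submodule.span ℝ (basisVec q '' (J : Set ℕ)) := by
  unfold residual
  rw [sub_sub_cancel]
  exact Submodule.sum_mem _ fun i hi => Submodule.smul_mem _ _ (Submodule.subset_span ⟨i, hi, rfl⟩)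

theorem apply_eq_zero_of_mem_span {q : ℝ} {J : Set ℕ} {G : ellq q}
    (hG : G ∈ Submodule.span ℝ (basisVec q '' J)) {j : ℕ} (hj : j ∉ J) : G j = 0 := by
  induction hG using Submodule.span_induction with
  | mem x hx =>
    obtain ⟨i, hi, rfl⟩ := hx
    rw [basisVec_apply, if_neg]
    rintro rfl
    exact hj hi
  | zero => rfl
  | add x y _ _ hx hy =>
    change x j + y j = 0
    rw [hx, hy, add_zero]
  | smul c x _ hx =>
    change c * x j = 0
    rw [hx, mul_zero]

/-- Subtracting `G` cannot change coordinates outside `J`, and inside `J` the residual is already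
zero. -/
theorem norm_residual_le {q : ℝ} (hq : 1 < q) (f : ellq q) {J : Finset ℕ} {G : ellq q}
    (hG : G ∈ Submodule.span ℝ (basisVec q '' (J : Set ℕ))) : ‖residual f J‖ ≤ ‖f - G‖ := by
  refine lp.norm_mono (ENNReal.ofReal_pos.2 (by linarith)).ne' fun j => ?_
  rw [residual_apply, Real.norm_eq_abs, Real.norm_eq_abs]
  split_ifs with hj
  · rw [abs_zero]
    exact abs_nonneg _
  · change _ ≤ |f j - G j|
    rw [apply_eq_zero_of_mem_span hG (by simpa using hj), sub_zero]

section

variable {q : ℝ} [Fact (1 ≤ ENNReal.ofReal q)]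

/-- The norming functional of a vector of `ℓ_q` with non-negative coordinates. -/
theorem exists_norming_functional (hq : 1 < q) {z : ellq q} (hz : ∀ i, 0 ≤ z i) (hz0 : 0 < ‖z‖) :
    ∃ F : ellq q →L[ℝ] ℝ, ‖F‖ ≤ 1 ∧
      ∀ y : ellq q, HasSum (fun i => z i ^ (q - 1) * y i) (‖z‖ ^ (q - 1) * F y) := by
  have hc := (Real.HolderConjugate.conjExponent hq).symm
  have hq1 : q - 1 ≠ 0 := by linarith
  have hz0' : 0 < ‖z‖ ^ (q - 1) := Real.rpow_pos_of_pos hz0 _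
  have hpow : ∀ a : ℝ, 0 ≤ a → (a ^ (q - 1)) ^ (Real.conjExponent q) = a ^ q := fun a ha => by
    rw [← Real.rpow_mul ha]
    congr 1
    unfold Real.conjExponent
    field_simp
  have hzs : HasSum (fun i => (z i ^ (q - 1)) ^ (Real.conjExponent q)) (‖z‖ ^ q) := by
    have h := ellq_hasSum_norm hq z
    simp_rw [abs_of_nonneg (hz _)] at h
    simpa only [hpow _ (hz _)] using h
  -- Hölder's inequality: with the conjugate exponent `p`, the `ℓ_p` norm of `z_i^{q-1}` is
  -- `‖z‖^{q-1}`, because `(q - 1)p = q`.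
  have hH : ∀ y : ellq q, Summable (fun i => z i ^ (q - 1) * |y i|) ∧
      ∑' i, z i ^ (q - 1) * |y i| ≤ ‖z‖ ^ (q - 1) * ‖y‖ := by
    intro y
    have hy := ellq_hasSum_norm hq y
    have h := Real.summable_and_inner_le_Lp_mul_Lq_tsum_of_nonneg hc
      (fun i => Real.rpow_nonneg (hz i) (q - 1)) (fun i => abs_nonneg (y i)) hzs.summable
      hy.summable
    refine ⟨h.1, h.2.trans_eq ?_⟩
    rw [hzs.tsum_eq, hy.tsum_eq, ← hpow _ hz0.le, ← Real.rpow_mul hz0'.le,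
      ← Real.rpow_mul (norm_nonneg y), mul_one_div_cancel hc.ne_zero, mul_one_div_cancel (by linarith),
      Real.rpow_one, Real.rpow_one]
  have hnorm : ∀ (y : ellq q) i, ‖z i ^ (q - 1) * y i‖ = z i ^ (q - 1) * |y i| := fun y i => by
    rw [norm_mul, Real.norm_of_nonneg (Real.rpow_nonneg (hz i) _), Real.norm_eq_abs]
  have hsum : ∀ y : ellq q, Summable (fun i => z i ^ (q - 1) * y i) := fun y =>
    Summable.of_norm ((hH y).1.congr fun i => (hnorm y i).symm)
  let L : ellq q →ₗ[ℝ] ℝ :=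
    { toFun := fun y => (‖z‖ ^ (q - 1))⁻¹ * ∑' i, z i ^ (q - 1) * y i
      map_add' := fun x y => by
        have h : ∑' i, z i ^ (q - 1) * (x + y) i
            = ∑' i, z i ^ (q - 1) * x i + ∑' i, z i ^ (q - 1) * y i := by
          rw [← (hsum x).tsum_add (hsum y)]
          refine tsum_congr fun i => ?_
          change _ * (x i + y i) = _
          ring
        rw [h, mul_add]
      map_smul' := fun c x => by
        have h : ∑' i, z i ^ (q - 1) * (c • x) i = c * ∑' i, z i ^ (q - 1) * x i := by
          rw [← tsum_mul_left]
          refine tsum_congr fun i => ?_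
          change _ * (c * x i) = _
          ring
        rw [RingHom.id_apply, smul_eq_mul, h, mul_left_comm] }
  have hL : ∀ y, ‖L y‖ ≤ 1 * ‖y‖ := fun y => by
    change ‖(‖z‖ ^ (q - 1))⁻¹ * ∑' i, z i ^ (q - 1) * y i‖ ≤ _
    rw [norm_mul, norm_inv, Real.norm_of_nonneg hz0'.le, inv_mul_le_iff₀ hz0', one_mul]
    have h := norm_tsum_le_tsum_norm (hsum y).norm
    simp_rw [hnorm y] at h
    exact h.trans (hH y).2
  refine ⟨L.mkContinuous 1 hL, L.mkContinuous_norm_le zero_le_one hL, fun y => ?_⟩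
  have : ‖z‖ ^ (q - 1) * L.mkContinuous 1 hL y = ∑' i, z i ^ (q - 1) * y i := by
    change ‖z‖ ^ (q - 1) * ((‖z‖ ^ (q - 1))⁻¹ * ∑' i, z i ^ (q - 1) * y i) = _
    rw [mul_inv_cancel_left₀ hz0'.ne']
  rw [this]
  exact (hsum y).hasSum

/-- Divergence from a step-by-step description: `φ_{n+1} = e_{ι n}`, the `n`-th residual is `y`,
and the `n`-th functional is `F`. -/
theorem diverges_of_steps (hq : 1 < q) {P : Parameters} {f : ellq q} (ι : ℕ → ℕ) {B : Set ℕ}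
    (hB : ∃ᶠ n in atTop, n ∈ B) {κ : ℝ} (hκ : 0 < κ)
    (h : ∀ n, ∃ (y : ellq q) (F : ellq q →L[ℝ] ℝ),
      f - y ∈ Submodule.span ℝ (basisVec q '' ((Finset.range n).image ι : Finset ℕ)) ∧
      ‖F‖ ≤ 1 ∧ (1 - P.δ n) * ‖y‖ - P.δ' n ≤ F y ∧
      (∀ i, P.t (n + 1) * |F (basisVec q i)| - P.t' (n + 1) ≤ F (basisVec q (ι n))) ∧
      (1 ≤ n → ‖y‖ ≤ (1 + P.η n) * ‖residual f ((Finset.range n).image ι)‖ + P.η' n) ∧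
      (n ∈ B → κ ≤ ‖y‖)) :
    Diverges P (canonicalDictionary q) f := by
  choose y F hy hF hFy hgr hη hBy using h
  -- Index shift: `φ_m = e_{ι (m - 1)}`, so the choice made from the `n`-th residual is `ι n`.
  have hspan : ∀ n, approxSpace (fun m => basisVec q (ι (m - 1))) n
      = Submodule.span ℝ (basisVec q '' ((Finset.range n).image ι : Finset ℕ)) := by
    intro n
    unfold approxSpace
    congr 1
    ext v
    constructor
    · rintro ⟨m, ⟨h1, h2⟩, rfl⟩
      exact ⟨ι (m - 1), Finset.mem_coe.2 (Finset.mem_image_of_mem ι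
        (Finset.mem_range.2 (by omega))), rfl⟩
    · rintro ⟨i, hi, rfl⟩
      obtain ⟨m, hm, rfl⟩ := Finset.mem_image.1 (Finset.mem_coe.1 hi)
      exact ⟨m + 1, ⟨by omega, Finset.mem_range.1 hm⟩, rfl⟩
  refine ⟨F, fun n => basisVec q (ι (n - 1)), fun n => f - y n, ?_, ?_⟩
  · constructor
    · simpa using hy 0
    · exact hF
    · intro n
      rw [sub_sub_cancel]
      exact hFy n
    · exact fun n _ => ⟨_, Or.inl rfl⟩
    · intro n hn
      obtain ⟨n, rfl⟩ : ∃ m, n = m + 1 := ⟨n - 1, by omega⟩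
      rw [Nat.add_sub_cancel]
      have : Nonempty (canonicalDictionary q) := ⟨⟨basisVec q 0, 0, Or.inl rfl⟩⟩
      rcases (P.t_succ_nonneg n).eq_or_lt with ht | ht
      · have h1 := hgr n 0
        rw [← ht] at h1 ⊢
        simpa using h1
      · have hsup : (⨆ g : canonicalDictionary q, F n (g : ellq q))
            ≤ (F n (basisVec q (ι n)) + P.t' (n + 1)) / P.t (n + 1) := by
          refine ciSup_le ?_
          have hi : ∀ i, |F n (basisVec q i)|
              ≤ (F n (basisVec q (ι n)) + P.t' (n + 1)) / P.t (n + 1) := fun i => by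
            rw [le_div_iff₀ ht, mul_comm]
            linarith [hgr n i]
          rintro ⟨g, i, rfl | rfl⟩
          · exact (le_abs_self _).trans (hi i)
          · refine le_trans ?_ (hi i)
            rw [map_neg]
            exact neg_le_abs _
        rw [le_div_iff₀ ht] at hsup
        linarith
    · intro n _
      rw [hspan]
      exact hy n
    · intro n hn
      rw [sub_sub_cancel]
      refine (hη n hn).trans ?_
      have h1 : ‖residual f ((Finset.range n).image ι)‖
          ≤ bestError f (fun m => basisVec q (ι (m - 1))) n := by
        refine le_ciInf fun G => norm_residual_le hq f ?_
        rw [← hspan]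
        exact G.2
      have h2 := P.η_nonneg n hn
      gcongr
  · intro hlim
    have h1 : Tendsto (fun n => ‖y n‖) atTop (𝓝 0) := by
      have := (hlim.const_sub f).norm
      simpa using this
    obtain ⟨n, hn1, hn2⟩ := (hB.and_eventually (h1.eventually (gt_mem_nhds hκ))).exists
    exact absurd (hBy n hn1) (not_le.2 hn2)

end

/-! ### Single steps of the divergent realizations -/

theorem add_smul_basisVec_apply {q : ℝ} (r : ellq q) (c : ℝ) (w i : ℕ) :
    (r + c • basisVec q w : ellq q) i = r i + if i = w then c else 0 := by
  change r i + c * basisVec q w i = _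
  rw [basisVec_apply]
  simp

theorem norm_add_smul_basisVec_rpow {q : ℝ} (hq : 1 < q) {r : ellq q} {w : ℕ} (hw : r w = 0)
    {c : ℝ} (hc : 0 ≤ c) : ‖r + c • basisVec q w‖ ^ q = ‖r‖ ^ q + c ^ q := by
  have h1 := ellq_hasSum_norm hq (r + c • basisVec q w)
  have h2 := (ellq_hasSum_norm hq r).add (hasSum_ite_eq w (c ^ q))
  refine h1.unique ?_
  convert h2 using 2 with i
  rw [add_smul_basisVec_apply]
  split_ifs with hi
  · rw [hi, hw, zero_add, abs_of_nonneg hc, abs_zero, Real.zero_rpow (by linarith), zero_add]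
  · rw [add_zero, add_zero]

section

variable {q : ℝ} [Fact (1 ≤ ENNReal.ofReal q)]

theorem exists_norming_functional_apply (hq : 1 < q) {z : ellq q} (hz : ∀ i, 0 ≤ z i)
    (hz0 : 0 < ‖z‖) :
    ∃ F : ellq q →L[ℝ] ℝ, ‖F‖ ≤ 1 ∧ F z = ‖z‖ ∧
      (∀ i, F (basisVec q i) = z i ^ (q - 1) / ‖z‖ ^ (q - 1)) ∧
      ∀ r : ellq q, (∀ i, r i = 0 ∨ r i = z i) → F r = ‖r‖ ^ q / ‖z‖ ^ (q - 1) := by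
  obtain ⟨F, hF, h⟩ := exists_norming_functional hq hz hz0
  have hz0' : 0 < ‖z‖ ^ (q - 1) := Real.rpow_pos_of_pos hz0 _
  have hr : ∀ r : ellq q, (∀ i, r i = 0 ∨ r i = z i) → F r = ‖r‖ ^ q / ‖z‖ ^ (q - 1) := by
    intro r hr
    rw [eq_div_iff hz0'.ne', mul_comm]
    refine (h r).unique ?_
    have h1 := ellq_hasSum_norm hq r
    convert h1 using 2 with i
    rcases hr i with hi | hi
    · rw [hi, mul_zero, abs_zero, Real.zero_rpow (by linarith)]
    · rw [hi, abs_of_nonneg (hz i)]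
      rcases (hz i).eq_or_lt with h0 | h0
      · rw [← h0, mul_zero, Real.zero_rpow (by linarith)]
      · rw [Real.rpow_sub_one h0.ne', div_mul_cancel₀ _ h0.ne']
  refine ⟨F, hF, ?_, fun i => ?_, hr⟩
  · rw [hr z fun i => Or.inr rfl, Real.rpow_sub_one hz0.ne']
    have := (Real.rpow_pos_of_pos hz0 q).ne'
    field_simp
  · rw [eq_div_iff hz0'.ne', mul_comm]
    refine (h _).unique ?_
    have h1 := hasSum_ite_eq i (z i ^ (q - 1))
    convert h1 using 2 with j
    rw [basisVec_apply]
    split_ifs with hj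
    · rw [hj, mul_one]
    · rw [mul_zero]

/-- A norming functional that is compatible with the greedy choice of the coordinate `j`. -/
theorem exists_greedy_norming_functional (hq : 1 < q) {z : ellq q} (hz : ∀ i, 0 ≤ z i)
    (hz0 : 0 < ‖z‖) {t : ℝ} {j : ℕ} (hj : ∀ i, t * z i ^ (q - 1) ≤ z j ^ (q - 1)) :
    ∃ F : ellq q →L[ℝ] ℝ, ‖F‖ ≤ 1 ∧ F z = ‖z‖ ∧
      (∀ i, t * |F (basisVec q i)| ≤ F (basisVec q j)) ∧
      ∀ r : ellq q, (∀ i, r i = 0 ∨ r i = z i) → F r = ‖r‖ ^ q / ‖z‖ ^ (q - 1) := by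
  obtain ⟨F, hF, hFz, hFe, hFr⟩ := exists_norming_functional_apply hq hz hz0
  refine ⟨F, hF, hFz, fun i => ?_, hFr⟩
  have h0 : 0 ≤ z i ^ (q - 1) / ‖z‖ ^ (q - 1) :=
    div_nonneg (Real.rpow_nonneg (hz i) _) (Real.rpow_nonneg (norm_nonneg z) _)
  rw [hFe, hFe, abs_of_nonneg h0, ← mul_div_assoc]
  have := hj i
  gcongr

end

/-- With `x = s / A^q`, one has `Z ≤ A(1 + x)` and, as `q - 1 ≤ 1`, also `Z^{q-1} ≤ A^{q-1}(1 + x)`;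
the second bound is then `(1 - x)(1 + x) ≤ 1`. It controls the loss when `r` is measured by the
norming functional of `r + c e_w`. -/
theorem rpow_perturbation {q A Z s : ℝ} (hq : 1 < q) (hq2 : q ≤ 2) (hA : 0 < A) (hZ : 0 < Z)
    (hs : 0 ≤ s) (h : Z ^ q = A ^ q + s) :
    Z ≤ A + A ^ (1 - q) * s ∧ A - A ^ (1 - q) * s ≤ A ^ q / Z ^ (q - 1) := by
  have hAq : 0 < A ^ q := Real.rpow_pos_of_pos hA q
  set x : ℝ := s / A ^ q with hx
  have hx0 : 0 ≤ x := by positivity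
  have hAx : A ^ (1 - q) * s = A * x := by
    rw [Real.rpow_sub hA, Real.rpow_one, hx]
    ring
  have hZA : Z ≤ A * (1 + x) := by
    refine (Real.rpow_le_rpow_iff hZ.le (by positivity) (by linarith : 0 < q)).1 ?_
    rw [h, Real.mul_rpow hA.le (by positivity)]
    calc A ^ q + s = A ^ q * (1 + x) := by rw [hx]; field_simp
      _ ≤ A ^ q * (1 + x) ^ q := by
        gcongr
        exact Real.self_le_rpow_of_one_le (by linarith) hq.le
  refine ⟨by rw [hAx]; linarith, ?_⟩
  have hZ1 : Z ^ (q - 1) ≤ A ^ (q - 1) * (1 + x) := by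
    calc Z ^ (q - 1) ≤ (A * (1 + x)) ^ (q - 1) := Real.rpow_le_rpow hZ.le hZA (by linarith)
      _ = A ^ (q - 1) * (1 + x) ^ (q - 1) := Real.mul_rpow hA.le (by positivity)
      _ ≤ A ^ (q - 1) * (1 + x) ^ (1 : ℝ) := by
        gcongr
        · linarith
        · linarith
      _ = A ^ (q - 1) * (1 + x) := by rw [Real.rpow_one]
  rw [hAx, le_div_iff₀ (Real.rpow_pos_of_pos hZ _)]
  have hA1 : A * A ^ (q - 1) = A ^ q := by
    rw [Real.rpow_sub_one hA.ne', mul_div_cancel₀ _ hA.ne']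
  have hZn : 0 ≤ Z ^ (q - 1) := Real.rpow_nonneg hZ.le _
  rcases le_or_gt x 1 with h1 | h1
  · calc (A - A * x) * Z ^ (q - 1) ≤ (A - A * x) * (A ^ (q - 1) * (1 + x)) := by
          refine mul_le_mul_of_nonneg_left hZ1 ?_
          nlinarith
      _ = A ^ q * (1 - x ^ 2) := by rw [← hA1]; ring
      _ ≤ A ^ q := by nlinarith [sq_nonneg x]
  · have : (A - A * x) * Z ^ (q - 1) ≤ 0 := mul_nonpos_of_nonpos_of_nonneg (by nlinarith) hZn
    linarith

section

variable {q : ℝ} [Fact (1 ≤ ENNReal.ofReal q)]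

/-- If one of the errors is large compared with `t`, a step of the algorithm may choose a
coordinate `w` in which the residual vanishes already. -/
theorem exists_wasted_step (hq : 1 < q) (hq2 : q ≤ 2) {p : ℝ} (hp : p = q / (q - 1))
    {r : ellq q} (hr0 : ∀ i, 0 ≤ r i) (hr1 : ∀ i, r i ≤ 1) {w : ℕ} (hw : r w = 0)
    (hA : 1 ≤ ‖r‖) {ε : ℝ} (hε : ‖r‖ ^ (1 - q) ≤ ε) {t t' δ δ' η η' : ℝ} (ht0 : 0 ≤ t)
    (ht1 : t ≤ 1) (ht' : 0 ≤ t') (hδ : 0 ≤ δ) (hδ' : 0 ≤ δ') (hη : 0 ≤ η) (hη' : 0 ≤ η')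
    (hbad : ¬ (t' ≤ ε * t ∧ δ ≤ ε * t ^ p ∧ δ' ≤ ε * t ^ p ∧ η ≤ ε * t ^ p ∧ η' ≤ ε * t ^ p)) :
    ∃ (c : ℝ) (F : ellq q →L[ℝ] ℝ), ‖F‖ ≤ 1 ∧
      (1 - δ) * ‖r + c • basisVec q w‖ - δ' ≤ F (r + c • basisVec q w) ∧
      (∀ i, t * |F (basisVec q i)| - t' ≤ F (basisVec q w)) ∧
      ‖r + c • basisVec q w‖ ≤ (1 + η) * ‖r‖ + η' ∧ ‖r‖ ≤ ‖r + c • basisVec q w‖ := by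
  have hq1 : q - 1 ≠ 0 := by linarith
  have hr : 0 < ‖r‖ := by linarith
  have hδr : 0 ≤ δ * ‖r‖ := by positivity
  have hηr : 0 ≤ η * ‖r‖ := by positivity
  by_cases hc1 : t' ≤ ε * t
  swap
  -- Large `t'`: the values of the norming functional of `r` on the basis are at most `ε`, so even
  -- the value 0 at `e_w` is admissible.
  · obtain ⟨F, hF, hFr, hFe, -⟩ := exists_norming_functional_apply hq hr0 hr
    refine ⟨0, F, hF, ?_, fun i => ?_, ?_, ?_⟩
    · rw [zero_smul, add_zero, hFr]
      linarith
    · rw [hFe w, hw, Real.zero_rpow hq1, zero_div, hFe i, abs_of_nonneg (by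
        have := hr0 i
        positivity)]
      have h1 : r i ^ (q - 1) / ‖r‖ ^ (q - 1) ≤ ε := by
        refine le_trans ?_ hε
        rw [show 1 - q = -(q - 1) by ring, Real.rpow_neg hr.le, ← one_div]
        gcongr
        exact Real.rpow_le_one (hr0 i) (hr1 i) (by linarith)
      have h2 := mul_le_mul_of_nonneg_left h1 ht0
      linarith
    · rw [zero_smul, add_zero]
      linarith
    · rw [zero_smul, add_zero]
  -- The size at which coordinate `w` becomes admissible against coordinates bounded by 1.
  set c : ℝ := t ^ (1 / (q - 1)) with hc
  have hc0 : 0 ≤ c := by positivity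
  have hcq1 : c ^ (q - 1) = t := by
    rw [hc, ← Real.rpow_mul ht0, one_div_mul_cancel hq1, Real.rpow_one]
  have hcq : c ^ q = t ^ p := by
    rw [hc, ← Real.rpow_mul ht0, hp]
    congr 1
    field_simp
  have hcle : c ≤ 1 := Real.rpow_le_one ht0 ht1 (div_nonneg zero_le_one (by linarith))
  have htp : 0 ≤ t ^ p := Real.rpow_nonneg ht0 p
  set z : ellq q := r + c • basisVec q w with hz
  have hzi : ∀ i, z i = r i + if i = w then c else 0 := add_smul_basisVec_apply r c w
  have hz0 : ∀ i, 0 ≤ z i := fun i => by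
    rw [hzi]
    have := hr0 i
    split_ifs <;> positivity
  have hz1 : ∀ i, z i ≤ 1 := fun i => by
    rw [hzi]
    split_ifs with h
    · rw [h, hw, zero_add]
      exact hcle
    · rw [add_zero]
      exact hr1 i
  have hzw : z w = c := by rw [hzi, hw, if_pos rfl, zero_add]
  have hzq : ‖z‖ ^ q = ‖r‖ ^ q + t ^ p := by rw [hz, norm_add_smul_basisVec_rpow hq hw hc0, hcq]
  have hrz : ‖r‖ ≤ ‖z‖ :=
    (Real.rpow_le_rpow_iff hr.le (norm_nonneg z) (by linarith : 0 < q)).1 (by linarith)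
  have hzpos : 0 < ‖z‖ := hr.trans_le hrz
  obtain ⟨hup, hlow⟩ := rpow_perturbation hq hq2 hr hzpos htp hzq
  obtain ⟨F, hF, hFz, hFe, hFr⟩ := exists_greedy_norming_functional hq hz0 hzpos
    (t := t) (j := w) fun i => by
      rw [hzw, hcq1]
      exact mul_le_of_le_one_right ht0 (Real.rpow_le_one (hz0 i) (hz1 i) (by linarith))
  have hs1 : ‖r‖ ^ (1 - q) * t ^ p ≤ ε * t ^ p := by gcongr
  have hs2 : ‖r‖ ^ (1 - q) * t ^ p ≤ ‖r‖ * (ε * t ^ p) := by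
    have : 0 ≤ ‖r‖ ^ (1 - q) * t ^ p := by positivity
    exact hs1.trans (le_mul_of_one_le_left (this.trans hs1) hA)
  have hFr' : ‖r‖ - ‖r‖ ^ (1 - q) * t ^ p ≤ F r := by
    rw [hFr r fun i => ?_]
    · exact hlow
    · rw [hzi]
      split_ifs with h
      · exact Or.inl (h ▸ hw)
      · exact Or.inr (add_zero _).symm
  by_cases hc2 : δ ≤ ε * t ^ p ∧ δ' ≤ ε * t ^ p
  -- Here `η` or `η'` is large: the residual itself may be `z`, with its exact norming functional.
  · refine ⟨c, F, hF, ?_, fun i => ?_, ?_, hrz⟩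
    · rw [← hz, hFz]
      linarith [mul_nonneg hδ hzpos.le]
    · linarith [hFe i]
    · rw [← hz]
      by_cases hc3 : η ≤ ε * t ^ p
      · have : ε * t ^ p < η' := by
          by_contra! h
          exact hbad ⟨hc1, hc2.1, hc2.2, hc3, h⟩
        linarith
      · linarith [mul_le_mul_of_nonneg_left (not_le.1 hc3).le hr.le]
  -- Here `δ` or `δ'` is large: the residual stays `r`, but the functional norming `z` is allowed.
  · refine ⟨0, F, hF, ?_, fun i => ?_, ?_, ?_⟩
    · rw [zero_smul, add_zero]
      by_cases hc3 : δ ≤ ε * t ^ p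
      · have : ε * t ^ p < δ' := by
          by_contra! h
          exact hc2 ⟨hc3, h⟩
        linarith
      · linarith [mul_le_mul_of_nonneg_left (not_le.1 hc3).le hr.le]
    · linarith [hFe i]
    · rw [zero_smul, add_zero]
      linarith
    · rw [zero_smul, add_zero]

end

/-! ### Divergent realizations in `ℓ_q` -/

theorem exists_ellq_apply_eq {q : ℝ} (hq : 1 < q) {x : ℕ → ℝ} (hx : ∀ i, 0 ≤ x i)
    (hs : Summable fun i => x i ^ q) : ∃ f : ellq q, ∀ i, f i = x i := by
  refine ⟨⟨x, memℓp_gen (hs.congr fun i => ?_)⟩, fun _ => rfl⟩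
  rw [ENNReal.toReal_ofReal (by linarith), Real.norm_of_nonneg (hx i)]

theorem ellq_sum_rpow_le {q : ℝ} (hq : 1 < q) (x : ellq q) (s : Finset ℕ) :
    ∑ i ∈ s, |x i| ^ q ≤ ‖x‖ ^ q :=
  sum_le_hasSum s (fun _ _ => by positivity) (ellq_hasSum_norm hq x)

/-- A positive decreasing sequence with finite sum and large values up to `2 (n_k + 1)`. -/
theorem exists_slow_sequence {n : ℕ → ℕ} (hn : StrictMono n) :
    ∃ a : ℕ → ℝ, Antitone a ∧ (∀ i, 0 < a i) ∧ (∀ i, a i ≤ 1) ∧ Summable a ∧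
      ∀ k i, i < 2 * (n k + 1) → (1 / 2 : ℝ) ^ k / (2 * ((n k : ℝ) + 1)) ≤ a i := by
  -- The function `b k` is constant on an initial segment and has total mass `2^{-k}`; the sequence
  -- is the sum over `k`.
  set b : ℕ → ℕ → ℝ := fun k i =>
    if i < 2 * (n k + 1) then (1 / 2 : ℝ) ^ k / (2 * ((n k : ℝ) + 1)) else 0 with hb
  have hb0 : ∀ k i, 0 ≤ b k i := fun k i => by
    simp only [hb]
    split_ifs <;> positivity
  have hb1 : ∀ k i, b k i ≤ (1 / 2 : ℝ) ^ k / 2 := fun k i => by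
    simp only [hb]
    split_ifs
    · gcongr
      have : (0 : ℝ) ≤ n k := Nat.cast_nonneg _
      linarith
    · positivity
  have hgeo : HasSum (fun k : ℕ => (1 / 2 : ℝ) ^ k) 2 := hasSum_geometric_two
  have hbs : ∀ i, Summable fun k => b k i := fun i =>
    Summable.of_nonneg_of_le (fun k => hb0 k i) (fun k => hb1 k i) (hgeo.summable.div_const 2)
  have hlow : ∀ k i, i < 2 * (n k + 1) →
      (1 / 2 : ℝ) ^ k / (2 * ((n k : ℝ) + 1)) ≤ ∑' k, b k i := fun k i hi => by
    have := (hbs i).le_tsum k fun j _ => hb0 j i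
    simpa only [hb, if_pos hi] using this
  refine ⟨fun i => ∑' k, b k i, fun i j hij => ?_, fun i => ?_, fun i => ?_, ?_, hlow⟩
  · refine (hbs j).tsum_le_tsum (fun k => ?_) (hbs i)
    by_cases hj : j < 2 * (n k + 1)
    · simp only [hb, if_pos hj, if_pos (hij.trans_lt hj), le_refl]
    · simp only [hb, if_neg hj]
      exact hb0 k i
  · refine lt_of_lt_of_le ?_ (hlow i i ?_)
    · positivity
    · have := hn.id_le i
      simp only [id] at this
      omega
  · refine ((hbs i).tsum_le_tsum (fun k => hb1 k i) (hgeo.summable.div_const 2)).trans_eq ?_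
    rw [(hgeo.div_const 2).tsum_eq]
    norm_num
  · refine summable_of_sum_range_le (c := 2) (fun i => tsum_nonneg fun k => hb0 k i) fun N => ?_
    rw [← Summable.tsum_finsetSum fun i _ => hbs i, ← hgeo.tsum_eq]
    refine Summable.tsum_le_tsum (fun k => ?_) (summable_sum fun i _ => hbs i) hgeo.summable
    simp only [hb]
    rw [← Finset.sum_filter, Finset.sum_const, nsmul_eq_mul]
    have hcard : (((Finset.range N).filter fun i => i < 2 * (n k + 1)).card : ℝ)
        ≤ 2 * ((n k : ℝ) + 1) := by
      have h1 : ((Finset.range N).filter fun i => i < 2 * (n k + 1)).card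
          ≤ (Finset.range (2 * (n k + 1))).card :=
        Finset.card_le_card fun i hi => Finset.mem_range.2 (Finset.mem_filter.1 hi).2
      rw [Finset.card_range] at h1
      exact_mod_cast h1
    calc _ ≤ 2 * ((n k : ℝ) + 1) * ((1 / 2 : ℝ) ^ k / (2 * ((n k : ℝ) + 1))) := by gcongr
      _ = (1 / 2 : ℝ) ^ k := by field_simp

theorem exists_sparse_large_of_not_bddAbove {η : ℕ → ℝ} (h : ¬ BddAbove (η '' Set.Ici 1)) :
    ∃ n : ℕ → ℕ, (∀ k, 1 ≤ n k) ∧ (∀ k, 2 * (n k + 1) ≤ n (k + 1)) ∧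
      ∀ k, (2 : ℝ) ^ (k + 1) ≤ η (n k) := by
  have hunb : ∀ (m : ℕ) (C : ℝ), ∃ n, m ≤ n ∧ C ≤ η n := by
    by_contra! hcon
    obtain ⟨m, C, hC⟩ := hcon
    obtain ⟨C', hC'⟩ := ((Set.finite_Iio m).image η).bddAbove
    refine h ⟨max C C', ?_⟩
    rintro _ ⟨n, -, rfl⟩
    rcases lt_or_ge n m with hn | hn
    · exact le_max_of_le_right (hC' ⟨n, hn, rfl⟩)
    · exact le_max_of_le_left (hC n hn).le
  choose g hg1 hg2 using hunb
  let n : ℕ → ℕ := fun k => Nat.rec (g 1 2) (fun k m => g (2 * (m + 1)) (2 ^ (k + 2))) k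
  have h2 : ∀ k, 2 * (n k + 1) ≤ n (k + 1) := fun k => hg1 _ _
  refine ⟨n, fun k => ?_, h2, fun k => ?_⟩
  · cases k with
    | zero => exact hg1 _ _
    | succ k => exact le_trans (by omega) (h2 k)
  · cases k with
    | zero =>
      rw [zero_add, pow_one]
      exact hg2 1 2
    | succ k => exact hg2 _ _

theorem norm_basisVec {q : ℝ} (hq : 1 < q) (i : ℕ) : ‖basisVec q i‖ = 1 := by
  unfold basisVec
  rw [lp.norm_single (ENNReal.ofReal_pos.2 (by linarith)), norm_one]

section

variable {q : ℝ} [Fact (1 ≤ ENNReal.ofReal q)]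

theorem exists_diverges_of_not_tendsto (hq : 1 < q) {P : Parameters}
    (h : ¬ Tendsto P.η' atTop (𝓝 0)) :
    ∃ f : ellq q, Diverges P (canonicalDictionary q) f := by
  obtain ⟨κ, hκ, hfr⟩ : ∃ κ : ℝ, 0 < κ ∧ ∃ᶠ n in atTop, κ ≤ |P.η' n| := by
    by_contra! hcon
    refine h (Metric.tendsto_nhds.2 fun κ hκ => ?_)
    filter_upwards [hcon κ hκ] with n hn
    rw [Real.dist_eq, sub_zero]
    exact hn
  have hz : ∀ i, 0 ≤ basisVec q 0 i := fun i => by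
    rw [basisVec_apply]
    split_ifs <;> norm_num
  obtain ⟨F, hF, hF0, -, -⟩ := exists_norming_functional_apply hq hz
    (by rw [norm_basisVec hq]; exact one_pos)
  rw [norm_basisVec hq] at hF0
  refine ⟨basisVec q 0, diverges_of_steps hq (fun _ => 0) (B := {n | 1 ≤ n ∧ κ ≤ |P.η' n|})
    ?_ hκ fun n => ?_⟩
  · exact (hfr.and_eventually (eventually_ge_atTop 1)).mono fun n hn => ⟨hn.2, hn.1⟩
  -- At `n = 0` the residual must be `f`; afterwards the best error is 0 and the residual spends all
  -- of `η'_n`.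
  · set c : ℝ := if n = 0 then 1 else P.η' n with hc
    have hc1 : 1 ≤ n → c = P.η' n := fun hn => if_neg (by omega)
    have hc0 : 0 ≤ c := by
      rcases Nat.eq_zero_or_pos n with hn | hn
      · rw [hc, if_pos hn]
        exact zero_le_one
      · rw [hc1 hn]
        exact P.η'_nonneg n hn
    have hnorm : ‖c • basisVec q 0‖ = c := by
      rw [norm_smul, norm_basisVec hq, mul_one, Real.norm_of_nonneg hc0]
    refine ⟨c • basisVec q 0, F, ?_, hF, ?_, fun i => ?_, fun hn => ?_, fun hn => ?_⟩
    · rcases Nat.eq_zero_or_pos n with hn | hn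
      · rw [hc, if_pos hn, one_smul, sub_self]
        exact Submodule.zero_mem _
      · have : basisVec q 0 ∈ Submodule.span ℝ
            (basisVec q '' ((Finset.range n).image fun _ => 0 : Finset ℕ)) :=
          Submodule.subset_span ⟨0, Finset.mem_coe.2 (Finset.mem_image.2
            ⟨0, Finset.mem_range.2 hn, rfl⟩), rfl⟩
        exact Submodule.sub_mem _ this (Submodule.smul_mem _ _ this)
    · rw [hnorm, map_smul, hF0, smul_eq_mul, mul_one]
      linarith [mul_nonneg (P.δ_nonneg n) hc0, P.δ'_nonneg n]
    · rw [hF0]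
      have h1 := F.le_of_opNorm_le hF (basisVec q i)
      rw [norm_basisVec hq, Real.norm_eq_abs] at h1
      have h2 := mul_le_mul (P.t_succ_le_one n) h1 (abs_nonneg _) zero_le_one
      linarith [P.t'_nonneg (n + 1) (by omega)]
    · rw [hnorm, hc1 hn]
      have := P.η_nonneg n hn
      exact le_add_of_nonneg_left (mul_nonneg (by linarith) (norm_nonneg _))
    · rw [hnorm, hc1 hn.1, ← abs_of_nonneg (P.η'_nonneg n hn.1)]
      exact hn.2

theorem exists_diverges_of_not_bddAbove (hq : 1 < q) {P : Parameters}
    (h : ¬ BddAbove (P.η '' Set.Ici 1)) :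
    ∃ f : ellq q, Diverges P (canonicalDictionary q) f := by
  classical
  obtain ⟨n, hn1, hn2, hnη⟩ := exists_sparse_large_of_not_bddAbove h
  have hmono : StrictMono n := strictMono_nat_of_lt_succ fun k => by have := hn2 k; omega
  obtain ⟨a, ha, ha0, ha1, has, hak⟩ := exists_slow_sequence hmono
  set B : Set ℕ := Set.range n with hB
  have h0B : 0 ∉ B := by
    rintro ⟨k, hk⟩
    have := hn1 k
    omega
  have hpow : ∀ i, (a i ^ (1 / q)) ^ q = a i := fun i => by
    rw [← Real.rpow_mul (ha0 i).le, one_div_mul_cancel (by linarith), Real.rpow_one]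
  have hx0 : ∀ i, 0 ≤ if i ∈ B then 0 else a i ^ (1 / q) := fun i => by
    have := (ha0 i).le
    split_ifs <;> positivity
  obtain ⟨f, hf⟩ := exists_ellq_apply_eq hq hx0 (has.of_nonneg_of_le
    (fun i => Real.rpow_nonneg (hx0 i) q) fun i => by
      split_ifs
      · rw [Real.zero_rpow (by linarith)]
        exact (ha0 i).le
      · rw [hpow])
  -- Steps in `B` reuse coordinate 0, so the coordinates in `B` never get their turn; this is why
  -- `f` vanishes there.
  set ι : ℕ → ℕ := fun m => if m ∈ B then 0 else m with hι
  have hιle : ∀ m, ι m ≤ m := fun m => by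
    simp only [hι]
    split_ifs <;> omega
  refine ⟨f, diverges_of_steps hq ι (B := B) ?_ one_pos fun m => ?_⟩
  · exact Nat.frequently_atTop_iff_infinite.2 (Set.infinite_range_of_injective hmono.injective)
  set J : Finset ℕ := (Finset.range m).image ι with hJ
  have hJlt : ∀ i ∈ J, i < m := fun i hi => by
    obtain ⟨j, hj, rfl⟩ := Finset.mem_image.1 hi
    exact (hιle j).trans_lt (Finset.mem_range.1 hj)
  have hr : ∀ i, residual f J i = if i ∈ J then 0 else if i ∈ B then 0 else a i ^ (1 / q) :=
    fun i => by rw [residual_apply, hf]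
  have hr0 : ∀ i, 0 ≤ residual f J i := fun i => by
    rw [hr]
    split_ifs
    · exact le_rfl
    · exact le_rfl
    · exact Real.rpow_nonneg (ha0 i).le _
  have hrle : ∀ i, residual f J i ≤ a i ^ (1 / q) := fun i => by
    rw [hr]
    have := (ha0 i).le
    split_ifs
    · positivity
    · positivity
    · exact le_rfl
  have hq0 : 0 ≤ 1 / q := div_nonneg zero_le_one (by linarith)
  by_cases hm : m ∈ B
  · obtain ⟨k, hk⟩ := hm
    have hm1 : 1 ≤ m := hk ▸ hn1 k
    have h0J : 0 ∈ J := Finset.mem_image.2 ⟨0, Finset.mem_range.2 hm1, if_neg h0B⟩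
    have hr00 : residual f J 0 = 0 := by rw [hr, if_pos h0J]
    -- Coordinate 0 returns with value 1. This is affordable since `η_m ≥ 2^{k+1}` while the best
    -- error is at least `2^{-(k+1)}`.
    set z : ellq q := residual f J + (1 : ℝ) • basisVec q 0 with hz
    have hzi : ∀ i, z i = residual f J i + if i = 0 then 1 else 0 :=
      add_smul_basisVec_apply _ _ _
    have hz0 : ∀ i, 0 ≤ z i := fun i => by
      rw [hzi]
      have := hr0 i
      split_ifs <;> positivity
    have hz1 : ∀ i, z i ≤ 1 := fun i => by
      rw [hzi]
      split_ifs with hi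
      · rw [hi, hr00, zero_add]
      · rw [add_zero]
        exact (hrle i).trans (Real.rpow_le_one (ha0 i).le (ha1 i) hq0)
    have hzq : ‖z‖ ^ q = ‖residual f J‖ ^ q + 1 := by
      rw [hz, norm_add_smul_basisVec_rpow hq hr00 zero_le_one, Real.one_rpow]
    have hznorm : 1 ≤ ‖z‖ := by
      refine (Real.rpow_le_rpow_iff zero_le_one (norm_nonneg z) (by linarith : 0 < q)).1 ?_
      rw [hzq, Real.one_rpow]
      linarith [Real.rpow_nonneg (norm_nonneg (residual f J)) q]
    obtain ⟨F, hF, hFz, hFe, -⟩ := exists_greedy_norming_functional hq hz0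
      (zero_lt_one.trans_le hznorm) (t := P.t (m + 1)) (j := 0) fun i => by
        rw [hzi 0, hr00, if_pos rfl, zero_add, Real.one_rpow]
        exact mul_le_one₀ (P.t_succ_le_one m) (Real.rpow_nonneg (hz0 i) _)
          (Real.rpow_le_one (hz0 i) (hz1 i) (by linarith))
    refine ⟨z, F, ?_, hF, ?_, fun i => ?_, fun _ => ?_, fun _ => hznorm⟩
    · rw [hz, ← sub_sub]
      exact Submodule.sub_mem _ (sub_residual_mem f J) (Submodule.smul_mem _ _
        (Submodule.subset_span ⟨0, h0J, rfl⟩))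
    · rw [hFz]
      linarith [mul_nonneg (P.δ_nonneg m) (norm_nonneg z), P.δ'_nonneg m]
    · have : ι m = 0 := if_pos ⟨k, hk⟩
      rw [this]
      linarith [hFe i, P.t'_nonneg (m + 1) (by omega)]
    -- The open interval contains `n k + 1` indices, none chosen so far and, by sparsity, none in
    -- `B`.
    · have hsum : (1 / 2 : ℝ) ^ (k + 1) ≤ ‖residual f J‖ ^ q := by
        refine le_trans ?_ (ellq_sum_rpow_le hq _ (Finset.Ioo (n k) (2 * (n k + 1))))
        have hterm : ∀ i ∈ Finset.Ioo (n k) (2 * (n k + 1)),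
            (1 / 2 : ℝ) ^ k / (2 * ((n k : ℝ) + 1)) ≤ |residual f J i| ^ q := by
          intro i hi
          rw [Finset.mem_Ioo] at hi
          have hiJ : i ∉ J := fun hiJ => by
            have := hJlt i hiJ
            omega
          have hiB : i ∉ B := by
            rintro ⟨j, rfl⟩
            have h1 : k < j := hmono.lt_iff_lt.1 hi.1
            have h2 : n (k + 1) ≤ n j := hmono.monotone h1
            have := hn2 k
            omega
          rw [abs_of_nonneg (hr0 i), hr, if_neg hiJ, if_neg hiB, hpow]
          exact hak k i hi.2
        refine le_trans (le_of_eq ?_) (Finset.card_nsmul_le_sum _ _ _ hterm)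
        rw [Nat.card_Ioo, nsmul_eq_mul, show 2 * (n k + 1) - n k - 1 = n k + 1 by omega]
        push_cast
        field_simp
        ring
      have hlow : (1 / 2 : ℝ) ^ (k + 1) ≤ ‖residual f J‖ := by
        refine (Real.rpow_le_rpow_iff (by positivity) (norm_nonneg _) (by linarith : 0 < q)).1 ?_
        refine le_trans ?_ hsum
        exact Real.rpow_le_self_of_le_one (by positivity)
          (pow_le_one₀ (by norm_num) (by norm_num)) hq.le
      have hone : 1 ≤ P.η m * ‖residual f J‖ := by
        calc (1 : ℝ) = 2 ^ (k + 1) * (1 / 2 : ℝ) ^ (k + 1) := by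
              rw [← mul_pow]
              norm_num
          _ ≤ P.η m * ‖residual f J‖ := by
              have := P.η_nonneg m hm1
              have := hk ▸ hnη k
              gcongr
      have htri : ‖z‖ ≤ ‖residual f J‖ + 1 := by
        refine (norm_add_le _ _).trans_eq ?_
        rw [one_smul, norm_basisVec hq]
      linarith [P.η'_nonneg m hm1]
  · have hmJ : m ∉ J := fun hmJ => (hJlt m hmJ).false
    have hrm : residual f J m = a m ^ (1 / q) := by rw [hr, if_neg hmJ, if_neg hm]
    -- Earlier coordinates are removed or lie in `B`; later ones are no larger because `a`
    -- decreases.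
    have hmax : ∀ i, residual f J i ≤ residual f J m := fun i => by
      rcases lt_or_ge i m with hi | hi
      · have : residual f J i = 0 := by
          rw [hr]
          by_cases hiB : i ∈ B
          · rw [if_pos hiB, ite_self]
          · have hiJ : i ∈ J := Finset.mem_image.2 ⟨i, Finset.mem_range.2 hi, if_neg hiB⟩
            rw [if_pos hiJ]
        rw [this]
        exact hr0 m
      · rw [hrm]
        exact (hrle i).trans (Real.rpow_le_rpow (ha0 i).le (ha hi) hq0)
    have hpos : 0 < ‖residual f J‖ := by
      refine norm_pos_iff.2 fun h0 => ?_
      have h1 : residual f J m = 0 := by rw [h0]; rfl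
      rw [hrm] at h1
      exact (Real.rpow_pos_of_pos (ha0 m) _).ne' h1
    obtain ⟨F, hF, hFr, hFe, -⟩ := exists_greedy_norming_functional hq hr0 hpos
      (t := P.t (m + 1)) (j := m) fun i => by
        have h1 := Real.rpow_le_rpow (hr0 i) (hmax i) (by linarith : 0 ≤ q - 1)
        exact (mul_le_of_le_one_left (Real.rpow_nonneg (hr0 i) _) (P.t_succ_le_one m)).trans h1
    refine ⟨residual f J, F, sub_residual_mem f J, hF, ?_, fun i => ?_, fun hm1 => ?_,
      fun h1 => absurd h1 hm⟩
    · rw [hFr]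
      linarith [mul_nonneg (P.δ_nonneg m) hpos.le, P.δ'_nonneg m]
    · have : ι m = m := if_neg hm
      rw [this]
      linarith [hFe i, P.t'_nonneg (m + 1) (by omega)]
    · linarith [mul_nonneg (P.η_nonneg m hm1) hpos.le, P.η'_nonneg m hm1]

theorem exists_diverges_of_not_subsequenceCondition (hq : 1 < q) (hq2 : q ≤ 2) {p : ℝ}
    (hp : p = q / (q - 1)) {P : Parameters} (h : ¬ SubsequenceCondition p P) :
    ∃ f : ellq q, Diverges P (canonicalDictionary q) f := by
  classical
  obtain ⟨ε, hε, hsum⟩ := exists_summable_of_not_subsequenceCondition h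
  have hq1 : q - 1 ≠ 0 := by linarith
  -- Including 0 makes `e_N` the initial choice, so it is available for reuse at every bad step.
  set S : Set ℕ := insert 0 (goodSteps p P ε) with hS
  obtain ⟨μ, hμ0, hμ1, hμ⟩ := exists_pos_mul_rpow_le (s := q - 1) (by linarith) 1 hε
  rw [one_mul] at hμ
  -- The `N` untouched ones keep every residual norm above `μ⁻¹`, hence `‖r‖^{1-q} ≤ ε`.
  obtain ⟨N, hN⟩ := exists_nat_ge (μ⁻¹ ^ q)
  set c : ℕ → ℝ := fun n => P.t (n + 1) ^ (1 / (q - 1)) with hc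
  have hc0 : ∀ n, 0 ≤ c n := fun n => Real.rpow_nonneg (P.t_succ_nonneg n) _
  have hc1 : ∀ n, c n ≤ 1 := fun n => Real.rpow_le_one (P.t_succ_nonneg n) (P.t_succ_le_one n)
    (div_nonneg zero_le_one (by linarith))
  have hcq1 : ∀ n, c n ^ (q - 1) = P.t (n + 1) := fun n => by
    rw [hc, ← Real.rpow_mul (P.t_succ_nonneg n), one_div_mul_cancel hq1, Real.rpow_one]
  have hcq : ∀ n, c n ^ q = P.t (n + 1) ^ p := fun n => by
    rw [hc, ← Real.rpow_mul (P.t_succ_nonneg n), hp]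
    congr 1
    field_simp
  set x : ℕ → ℝ := fun i => if i < N then 1 else if i - N ∈ S then c (i - N) else 0 with hx
  have hx0 : ∀ i, 0 ≤ x i := fun i => by
    simp only [hx]
    split_ifs
    · exact zero_le_one
    · exact hc0 _
    · exact le_rfl
  have hx1 : ∀ i, x i ≤ 1 := fun i => by
    simp only [hx]
    split_ifs
    · exact le_rfl
    · exact hc1 _
    · exact zero_le_one
  have hxs : Summable fun i => x i ^ q := by
    refine (summable_nat_add_iff N).1 ?_
    refine Summable.of_nonneg_of_le (fun i => Real.rpow_nonneg (hx0 _) q) (fun i => ?_)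
      (hsum.add (hasSum_ite_eq 0 (c 0 ^ q)).summable)
    have hind : 0 ≤ (goodSteps p P ε).indicator (fun n => P.t (n + 1) ^ p) i :=
      Set.indicator_nonneg (fun n _ => Real.rpow_nonneg (P.t_succ_nonneg n) p) i
    have hite : 0 ≤ if i = 0 then c 0 ^ q else 0 := by
      have := hc0 0
      split_ifs <;> positivity
    simp only [hx, if_neg (show ¬ i + N < N by omega), Nat.add_sub_cancel]
    split_ifs with hi h0 h0
    · rw [h0]
      exact le_add_of_nonneg_left (h0 ▸ hind)
    · rw [Set.indicator_of_mem (hi.resolve_left h0), hcq, add_zero]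
    · exact absurd (Or.inl h0) hi
    · rw [Real.zero_rpow (by linarith), add_zero]
      exact hind
  obtain ⟨f, hf⟩ := exists_ellq_apply_eq hq hx0 hxs
  set ι : ℕ → ℕ := fun n => if n ∈ S then N + n else N with hι
  have h0S : 0 ∈ S := Set.mem_insert _ _
  refine ⟨f, diverges_of_steps hq ι (B := Set.univ) (Frequently.of_forall fun n => trivial)
    one_pos fun n => ?_⟩
  set J : Finset ℕ := (Finset.range n).image ι with hJ
  have hr : ∀ i, residual f J i = if i ∈ J then 0 else x i := fun i => by
    rw [residual_apply, hf]
  have hr0 : ∀ i, 0 ≤ residual f J i := fun i => by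
    rw [hr]
    split_ifs
    · exact le_rfl
    · exact hx0 i
  have hr1 : ∀ i, residual f J i ≤ 1 := fun i => by
    rw [hr]
    split_ifs
    · exact zero_le_one
    · exact hx1 i
  have hJN : ∀ i ∈ J, N ≤ i := fun i hi => by
    obtain ⟨j, -, rfl⟩ := Finset.mem_image.1 hi
    simp only [hι]
    split_ifs <;> omega
  have hnorm : μ⁻¹ ≤ ‖residual f J‖ := by
    refine (Real.rpow_le_rpow_iff (by positivity) (norm_nonneg _) (by linarith : 0 < q)).1 ?_
    refine hN.trans (le_trans (le_of_eq ?_) (ellq_sum_rpow_le hq _ (Finset.range N)))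
    rw [Finset.sum_congr rfl (g := fun _ => (1 : ℝ)) fun i hi => ?_]
    · simp
    · have hiN := Finset.mem_range.1 hi
      have hiJ : i ∉ J := fun hiJ => by
        have := hJN i hiJ
        omega
      rw [hr, if_neg hiJ]
      simp only [hx, if_pos hiN, abs_one, Real.one_rpow]
  have hnorm1 : 1 ≤ ‖residual f J‖ := ((one_le_inv₀ hμ0).2 hμ1).trans hnorm
  have hpos : 0 < ‖residual f J‖ := zero_lt_one.trans_le hnorm1
  have hnormε : ‖residual f J‖ ^ (1 - q) ≤ ε := by
    refine (Real.rpow_le_rpow_of_nonpos (by positivity) hnorm (by linarith)).trans ?_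
    rwa [Real.inv_rpow hμ0.le, ← Real.rpow_neg hμ0.le, neg_sub]
  by_cases hn : n ∈ S
  · have hιn : ι n = N + n := if_pos hn
    have hnJ : N + n ∉ J := fun hmem => by
      obtain ⟨j, hj, hje⟩ := Finset.mem_image.1 hmem
      rw [Finset.mem_range] at hj
      simp only [hι] at hje
      split_ifs at hje <;> omega
    have hrn : residual f J (N + n) = c n := by
      rw [hr, if_neg hnJ]
      simp only [hx, if_neg (show ¬ N + n < N by omega), Nat.add_sub_cancel_left, if_pos hn]
    obtain ⟨F, hF, hFr, hFe, -⟩ := exists_greedy_norming_functional hq hr0 hpos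
      (t := P.t (n + 1)) (j := N + n) fun i => by
        rw [hrn, hcq1]
        exact mul_le_of_le_one_right (P.t_succ_nonneg n)
          (Real.rpow_le_one (hr0 i) (hr1 i) (by linarith))
    refine ⟨residual f J, F, sub_residual_mem f J, hF, ?_, fun i => ?_, fun hn1 => ?_,
      fun _ => hnorm1⟩
    · rw [hFr]
      linarith [mul_nonneg (P.δ_nonneg n) hpos.le, P.δ'_nonneg n]
    · rw [hιn]
      linarith [hFe i, P.t'_nonneg (n + 1) (by omega)]
    · linarith [mul_nonneg (P.η_nonneg n hn1) hpos.le, P.η'_nonneg n hn1]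
  · have hn1 : 1 ≤ n := by
      rcases Nat.eq_zero_or_pos n with h0 | h0
      · exact absurd (h0 ▸ h0S) hn
      · exact h0
    have hιn : ι n = N := if_neg hn
    have hNJ : N ∈ J := Finset.mem_image.2 ⟨0, Finset.mem_range.2 hn1, if_pos h0S⟩
    obtain ⟨b, F, hF, hFy, hFe, hη, hle⟩ := exists_wasted_step hq hq2 hp hr0 hr1
      (by rw [hr, if_pos hNJ] : residual f J N = 0) hnorm1 hnormε (P.t_succ_nonneg n)
      (P.t_succ_le_one n) (P.t'_nonneg (n + 1) (by omega)) (P.δ_nonneg n) (P.δ'_nonneg n)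
      (P.η_nonneg n hn1) (P.η'_nonneg n hn1) fun hgood => hn (Or.inr ⟨hn1, hgood⟩)
    refine ⟨residual f J + b • basisVec q N, F, ?_, hF, hFy, ?_, fun _ => hη,
      fun _ => hnorm1.trans hle⟩
    · rw [← sub_sub]
      exact Submodule.sub_mem _ (sub_residual_mem f J) (Submodule.smul_mem _ _
        (Submodule.subset_span ⟨N, hNJ, rfl⟩))
    · rw [hιn]
      exact hFe

theorem exists_diverges_of_not_conditions (hq : 1 < q) (hq2 : q ≤ 2) {p : ℝ}
    (hp : p = q / (q - 1)) {P : Parameters}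
    (h : ¬ (ErrorCondition P ∧ SubsequenceCondition p P)) :
    ∃ f : ellq q, Diverges P (canonicalDictionary q) f := by
  by_cases h1 : BddAbove (P.η '' Set.Ici 1)
  · by_cases h2 : Tendsto P.η' atTop (𝓝 0)
    · exact exists_diverges_of_not_subsequenceCondition hq hq2 hp fun h3 => h ⟨⟨h1, h2⟩, h3⟩
    · exact exists_diverges_of_not_tendsto hq h2
  · exact exists_diverges_of_not_bddAbove hq h1

end

end GAWCGA

theorem theorem2 (q p : ℝ) (hq : 1 < q) (hq2 : q ≤ 2) (hp : p = q / (q - 1))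
    (P : GAWCGA.Parameters) :
    (GAWCGA.ConvergesOnClassP.{u} q P ↔
      GAWCGA.ErrorCondition P ∧ GAWCGA.SubsequenceCondition p P) ∧
    (haveI : Fact (1 ≤ ENNReal.ofReal q) := GAWCGA.fact_one_le hq;
      (GAWCGA.InClassP q (GAWCGA.ellq q) ∧
        GAWCGA.IsDictionary (GAWCGA.canonicalDictionary q) ∧
        (¬ (GAWCGA.ErrorCondition P ∧ GAWCGA.SubsequenceCondition p P) →
          ∃ f : GAWCGA.ellq q,
            GAWCGA.Diverges P (GAWCGA.canonicalDictionary q) f))) := by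
  have : Fact (1 ≤ ENNReal.ofReal q) := GAWCGA.fact_one_le hq
  have hX := GAWCGA.ellq_inClassP hq hq2
  have hD := GAWCGA.isDictionary_canonicalDictionary hq
  refine ⟨⟨fun hconv => ?_, fun h X _ _ _ hX D hD f =>
    GAWCGA.converges_of_conditions hq hp h.1 h.2 hX hD f⟩, hX, hD,
    GAWCGA.exists_diverges_of_not_conditions hq hq2 hp⟩
  by_contra hcon
  obtain ⟨f, hf⟩ := GAWCGA.exists_diverges_of_not_conditions hq hq2 hp hcon
  -- The convergence hypothesis concerns spaces in universe `u`, so the counterexample is moved to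
  -- an isometric lift of `ℓ_q`.
  let e : GAWCGA.ellq q ≃ₗᵢ[ℝ] ULift.{u} (GAWCGA.ellq q) := (LinearIsometryEquiv.ulift ℝ _).symm
  obtain ⟨F, φ, G, hR, hG⟩ := hf.congr e
  exact hG (hconv _ (hX.congr e) _ (hD.image e) _ F φ G hR)
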